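/- Let $\Gamma=\Gamma_1\cup\Gamma_2\subset\mathbb{R}^2=\mathbb{C}$ be the graph consisting of the unit circle $\Gamma_1=\{e^{i\theta}: 0\le\theta\le 2\pi\}$ and the half-line $\Gamma_2=\{(r,0): r>1\}$, with arc length $dx$. For a function $u$ on $\Gamma$ write $u_1(\theta)=u(e^{i\theta})$ and $u_2(r)=u(r,0)$ ($r\ge 1$). Let $H^1(\Gamma)$ be the space of continuous $u:\Gamma\to\mathbb{C}$ with $u_1\in H^1(0,2\pi)$ and $u_2\in H^1(1,\infty)$. For $0<\beta\le 1/2$ consider the equation $$\cos(2\pi\beta)=\cos(2\pi\sqrt{\lambda})-\frac{1-\sqrt{1-4\lambda}}{4\sqrt{\lambda}}\,\sin(2\pi\sqrt{\lambda}),\qquad \lambda\in(0,\beta^2). \tag{1}$$ Let $a\in L_2(0,2\pi)$ be real-valued, put $$h_a[u]=\int_0^{2\pi}|-iu_1'(\theta)-a(\theta)u_1(\theta)|^2\,d\theta+\int_1^\infty|u_2'(r)|^2\,dr ,\qquad \alpha=\frac1{2\pi}\int_0^{2\pi}a(\theta)\,d\theta,$$ and assume that $\alpha\notin\mathbb{Z}$.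 Let $\beta=\operatorname{dist}(\alpha,\mathbb{Z})\in(0,1/2]$. Then (1) has exactly one solution, denoted by $\lambda_*(\alpha)$ (so $\lambda_*$ is even and $1$-periodic in $\alpha$), and, all integrals being finite, $$h_a[u]\ \ge\ \lambda_*(\alpha)\int_\Gamma\psi\,|u|^2\,dx\qquad\text{for all }u\in H^1(\Gamma),$$ where $\psi=1$ on $\Gamma_1$ and $\psi(r,0)=r^{-2}$ on $\Gamma_2$. The constant is sharp: if $C\in\mathbb{R}$ and $h_a[u]\ge C\int_\Gamma\psi|u|^2\,dx$ for all $u\in H^1(\Gamma)$, then $C\le\lambda_*(\alpha)$. -/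

import Mathlib

open MeasureTheory Set
open scoped ContDiff

noncomputable section

/-- `g` is a weak (distributional) derivative of `f` on the open set `I ⊆ ℝ`. -/
def HasWeakDerivOn (I : Set ℝ) (f g : ℝ → ℂ) : Prop :=
  LocallyIntegrableOn f I ∧ LocallyIntegrableOn g I ∧
    ∀ φ : ℝ → ℝ, ContDiff ℝ ∞ φ → HasCompactSupport φ → tsupport φ ⊆ I →
      ∫ x in I, deriv φ x • f x = -∫ x in I, φ x • g x

open Classical in
/-- A representative of the weak derivative of `f` on `I` (unique up to null sets of `I`),
and `0` if there is none. -/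
def weakDerivOn (I : Set ℝ) (f : ℝ → ℂ) : ℝ → ℂ :=
  if h : ∃ g, HasWeakDerivOn I f g then h.choose else 0

/-- The Sobolev space `H¹(I)` of an open set `I ⊆ ℝ`. -/
def MemH1On (I : Set ℝ) (f : ℝ → ℂ) : Prop :=
  MemLp f 2 (volume.restrict I) ∧
    ∃ g, HasWeakDerivOn I f g ∧ MemLp g 2 (volume.restrict I)

namespace LoopGraph

/-- The loop graph `Γ = Γ₁ ∪ Γ₂` in `ℂ = ℝ²`: the unit circle `Γ₁` together with the half-line
`Γ₂ = {(r, 0) : r > 1}`. -/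
def graph : Set ℂ :=
  {z | ‖z‖ = 1} ∪ {z | ∃ r : ℝ, 1 < r ∧ z = (r : ℂ)}

theorem exp_mem_graph (θ : ℝ) : Complex.exp (θ * Complex.I) ∈ graph :=
  Or.inl (Complex.norm_exp_ofReal_mul_I θ)

theorem ofReal_mem_graph {r : ℝ} (hr : 1 ≤ r) : (r : ℂ) ∈ graph := by
  rcases hr.eq_or_lt with h | h
  · subst h
    exact Or.inl (by simp)
  · exact Or.inr ⟨r, h, rfl⟩

/-- The parameter interval of the circle, `θ ↦ e^{iθ}` (the vertex is `θ = 0` and `θ = 2π`). -/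
def circleEdge : Set ℝ := Ioo 0 (2 * Real.pi)

/-- The parameter interval of the half-line, `r ↦ (r, 0)`. -/
def rayEdge : Set ℝ := Ioi 1

/-- The restriction `u₁(θ) = u(e^{iθ})` of a function on the graph to the circle. -/
def onCircle {E : Type*} (u : graph → E) (θ : ℝ) : E :=
  u ⟨Complex.exp (θ * Complex.I), exp_mem_graph θ⟩

/-- The restriction `u₂(r) = u(r, 0)`, `r ≥ 1`, of a function on the graph to the half-line. The
value for `r < 1` is a dummy. -/
def onRay {E : Type*} [Zero E] (u : graph → E) (r : ℝ) : E :=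
  if hr : 1 ≤ r then u ⟨(r : ℂ), ofReal_mem_graph hr⟩ else 0

/-- Integrability over the graph with respect to arc length. -/
def GraphIntegrable (f : graph → ℝ) : Prop :=
  IntegrableOn (onCircle f) circleEdge ∧ IntegrableOn (onRay f) rayEdge

/-- The integral `∫_Γ f dx` over the graph with respect to arc length. -/
def graphIntegral (f : graph → ℝ) : ℝ :=
  (∫ θ in circleEdge, onCircle f θ) + ∫ r in rayEdge, onRay f r

/-- The Sobolev space `H¹(Γ)`: continuous functions on `Γ` that are in `H¹` of each edge. -/
def MemH1 (u : graph → ℂ) : Prop :=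
  Continuous u ∧ MemH1On circleEdge (onCircle u) ∧ MemH1On rayEdge (onRay u)

/-- The density `|-i u₁'(θ) - a(θ) u₁(θ)|²` of the magnetic energy on the circle. -/
def magneticDensity (a : ℝ → ℝ) (u : graph → ℂ) (θ : ℝ) : ℝ :=
  ‖-Complex.I * weakDerivOn circleEdge (onCircle u) θ - (a θ : ℂ) * onCircle u θ‖ ^ 2

/-- The density `|u₂'(r)|²` of the energy on the half-line. -/
def rayDensity (u : graph → ℂ) (r : ℝ) : ℝ :=
  ‖weakDerivOn rayEdge (onRay u) r‖ ^ 2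

/-- The quadratic form `h_a[u]`. -/
def magneticForm (a : ℝ → ℝ) (u : graph → ℂ) : ℝ :=
  (∫ θ in circleEdge, magneticDensity a u θ) + ∫ r in rayEdge, rayDensity u r

/-- The flux `α = (2π)⁻¹ ∫₀^{2π} a(θ) dθ`. -/
def flux (a : ℝ → ℝ) : ℝ :=
  1 / (2 * Real.pi) * ∫ θ in circleEdge, a θ

open Classical in
/-- The weight `ψ`: it is `1` on the circle and `r⁻²` at the point `(r, 0)` of the half-line. -/
def weight (x : graph) : ℝ :=
  if ‖(x : ℂ)‖ = 1 then 1 else ((x : ℂ).re ^ 2)⁻¹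

/-- `lam` is a solution in `(0, α²)` of the equation that defines `λ_*(α)` for `0 < α ≤ 1/2`. -/
def IsLambdaRoot (α lam : ℝ) : Prop :=
  lam ∈ Ioo 0 (α ^ 2) ∧
    Real.cos (2 * Real.pi * α) =
      Real.cos (2 * Real.pi * √lam) -
        (1 - √(1 - 4 * lam)) / (4 * √lam) * Real.sin (2 * Real.pi * √lam)

/-- The distance from `α` to the nearest integer; a number in `[0, 1/2]`. -/
def distInt (α : ℝ) : ℝ := |α - round α|

open Classical in
/-- The even, `1`-periodic function `λ_*` on `ℝ` whose value at `α ∈ (0, 1/2]` is the solution of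
the above equation in `(0, α²)`; it is `0` at the integers. -/
def lambdaStar (α : ℝ) : ℝ :=
  if h : ∃ lam, IsLambdaRoot (distInt α) lam then h.choose else 0

/-- The Hardy inequality `h_a[u] ≥ C ∫_Γ ψ |u|² dx` for all `u ∈ H¹(Γ)`. -/
def HardyInequality (a : ℝ → ℝ) (C : ℝ) : Prop :=
  ∀ u : graph → ℂ, MemH1 u →
    C * graphIntegral (fun x => weight x * ‖u x‖ ^ 2) ≤ magneticForm a u

end LoopGraph

end

/-! Completing squares turns `h_a[u] - λ ∫ψ|u|²` into a sum of two integrals of squares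
(`magneticForm_sub_eq`), for every root `λ` of the equation. Put `k = √λ` and let `γ < 1/2` be the
smaller solution of `γ(1-γ) = λ`.

On the circle the gauge factor `exp(-i∫a)` removes the magnetic potential at the price of a
quasiperiodic condition `v(2π) = q v(0)` with `q = exp(-2πiα)`. Solutions of `v'' = -k²v` are those
whose Wronskian with `cos(k(θ-π))` is a constant `c`. That cosine is positive on `[0, 2π]` because
`k < 1/2`, so the Wronskian relation can be divided by it; the resulting first order expression is
the square being completed (`integral_circle_eq`). With `c` read off from the boundary values, the
equation for `λ` says exactly that the boundary terms equal `γ|u(1)|²` (`circleBoundary_sub`). On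
the half-line the ground state is `r^γ`, and completing the square with `u' - γu/r` leaves
`-γ|u(1)|²` (`integral_ray_eq`). The two vertex terms cancel, which gives the inequality.

For sharpness, take the function annihilating the circle square and glue it to `r^γ exp(-ε(r-1))`.
The only remaining error is of order `ε^(1-2γ)`, and it tends to zero as `γ < 1/2`, while the mass
on the circle stays fixed (`le_of_hardyInequality`).

Existence of a root is the intermediate value theorem (`exists_isLambdaRoot`). Uniqueness needs no
study of the equation: every root is the best Hardy constant, and there is only one such constant.

Since `a` is merely square integrable, the gauged function is only absolutely continuous. All
integrations by parts therefore go through absolutely continuous functions and their a.e.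
derivatives, which are linked to weak derivatives by the lemma of du Bois-Reymond. -/

section

open Filter Topology

/-! ### Absolutely continuous functions and the fundamental theorem of calculus -/

/-- A function whose increments are controlled by those of an absolutely continuous function is
absolutely continuous. -/
theorem AbsolutelyContinuousOnInterval.of_dist_le {X Y : Type*} [PseudoMetricSpace X]
    [PseudoMetricSpace Y] {f : ℝ → X} {F : ℝ → Y} {a b C : ℝ}
    (hF : AbsolutelyContinuousOnInterval F a b)
    (h : ∀ x ∈ uIcc a b, ∀ y ∈ uIcc a b, dist (f x) (f y) ≤ C * dist (F x) (F y)) :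
    AbsolutelyContinuousOnInterval f a b := by
  unfold AbsolutelyContinuousOnInterval at hF ⊢
  refine squeeze_zero' (Eventually.of_forall fun _ => Finset.sum_nonneg fun _ _ => dist_nonneg)
    ?_ (by simpa using hF.const_mul C)
  rw [eventually_inf_principal]
  filter_upwards with E hE
  rw [Finset.mul_sum]
  exact Finset.sum_le_sum fun i hi => h _ (hE.1 i hi).1 _ (hE.1 i hi).2

/-- A Lipschitz function of an absolutely continuous function is absolutely continuous. -/
theorem LipschitzWith.comp_absolutelyContinuousOnInterval {X Y : Type*} [PseudoMetricSpace X]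
    [PseudoMetricSpace Y] {f : ℝ → X} {F : X → Y} {a b : ℝ} {K : NNReal} (hF : LipschitzWith K F)
    (hf : AbsolutelyContinuousOnInterval f a b) :
    AbsolutelyContinuousOnInterval (fun x => F (f x)) a b :=
  hf.of_dist_le (C := K) fun x _ y _ => hF.dist_le_mul (f x) (f y)

theorem AbsolutelyContinuousOnInterval.complex_re {f : ℝ → ℂ} {a b : ℝ}
    (hf : AbsolutelyContinuousOnInterval f a b) :
    AbsolutelyContinuousOnInterval (fun x => (f x).re) a b :=
  hf.of_dist_le (C := 1) fun x _ y _ => by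
    rw [one_mul, Real.dist_eq, Complex.dist_eq, ← Complex.sub_re]
    exact Complex.abs_re_le_norm _

theorem AbsolutelyContinuousOnInterval.complex_im {f : ℝ → ℂ} {a b : ℝ}
    (hf : AbsolutelyContinuousOnInterval f a b) :
    AbsolutelyContinuousOnInterval (fun x => (f x).im) a b :=
  hf.of_dist_le (C := 1) fun x _ y _ => by
    rw [one_mul, Real.dist_eq, Complex.dist_eq, ← Complex.sub_im]
    exact Complex.abs_im_le_norm _

theorem AbsolutelyContinuousOnInterval.congr {X : Type*} [PseudoMetricSpace X] {f F : ℝ → X}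
    {a b : ℝ} (hF : AbsolutelyContinuousOnInterval F a b) (h : EqOn f F (uIcc a b)) :
    AbsolutelyContinuousOnInterval f a b :=
  hF.of_dist_le (C := 1) fun x hx y hy => by rw [h hx, h hy, one_mul]

/-- The primitive of an integrable vector-valued function is absolutely continuous. -/
theorem IntervalIntegrable.absolutelyContinuousOnInterval_primitive {E : Type*}
    [NormedAddCommGroup E] [NormedSpace ℝ E] {f : ℝ → E} {a b c : ℝ}
    (h : IntervalIntegrable f volume a b) (hc : c ∈ uIcc a b) :
    AbsolutelyContinuousOnInterval (fun x => ∫ t in c..x, f t) a b := by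
  -- The increments are dominated by those of the primitive of `‖f‖`, which is real-valued.
  refine (h.norm.absolutelyContinuousOnInterval_intervalIntegral hc).of_dist_le (C := 1)
    fun x hx y hy => ?_
  have hi : ∀ z ∈ uIcc a b, IntervalIntegrable f volume c z := fun z hz =>
    h.mono_set (uIcc_subset_uIcc hc hz)
  rw [one_mul, dist_eq_norm, Real.dist_eq,
    intervalIntegral.integral_interval_sub_left (hi x hx) (hi y hy),
    intervalIntegral.integral_interval_sub_left (hi x hx).norm (hi y hy).norm]
  exact intervalIntegral.norm_integral_le_abs_integral_norm

/-- The a.e. derivative of an absolutely continuous function is integrable. -/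
theorem AbsolutelyContinuousOnInterval.intervalIntegrable_of_ae_hasDerivAt {f f' : ℝ → ℝ} {a b : ℝ}
    (hf : AbsolutelyContinuousOnInterval f a b)
    (h : ∀ᵐ x, x ∈ uIcc a b → HasDerivAt f (f' x) x) : IntervalIntegrable f' volume a b := by
  refine hf.intervalIntegrable_deriv.congr_ae ?_
  rw [EventuallyEq, ae_restrict_iff' measurableSet_uIoc]
  filter_upwards [h] with x hx hxm using (hx (uIoc_subset_uIcc hxm)).deriv

/-- The fundamental theorem of calculus for an absolutely continuous function. -/
theorem AbsolutelyContinuousOnInterval.integral_eq_sub_of_ae_hasDerivAt {f f' : ℝ → ℝ} {a b : ℝ}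
    (hf : AbsolutelyContinuousOnInterval f a b)
    (h : ∀ᵐ x, x ∈ uIcc a b → HasDerivAt f (f' x) x) : ∫ x in a..b, f' x = f b - f a := by
  rw [← hf.integral_deriv_eq_sub]
  refine intervalIntegral.integral_congr_ae ?_
  filter_upwards [h] with x hx hxm using (hx (uIoc_subset_uIcc hxm)).deriv.symm

theorem HasDerivAt.complex_re {f : ℝ → ℂ} {f' : ℂ} {x : ℝ} (h : HasDerivAt f f' x) :
    HasDerivAt (fun y => (f y).re) f'.re x :=
  Complex.reCLM.hasFDerivAt.comp_hasDerivAt x h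

theorem HasDerivAt.complex_im {f : ℝ → ℂ} {f' : ℂ} {x : ℝ} (h : HasDerivAt f f' x) :
    HasDerivAt (fun y => (f y).im) f'.im x :=
  Complex.imCLM.hasFDerivAt.comp_hasDerivAt x h

theorem AbsolutelyContinuousOnInterval.complex_intervalIntegrable {f f' : ℝ → ℂ} {a b : ℝ}
    (hf : AbsolutelyContinuousOnInterval f a b)
    (h : ∀ᵐ x, x ∈ uIcc a b → HasDerivAt f (f' x) x) : IntervalIntegrable f' volume a b := by
  have h1 := hf.complex_re.intervalIntegrable_of_ae_hasDerivAt
    (h.mono fun x hx hm => (hx hm).complex_re)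
  have h2 := hf.complex_im.intervalIntegrable_of_ae_hasDerivAt
    (h.mono fun x hx hm => (hx hm).complex_im)
  rw [intervalIntegrable_iff] at h1 h2 ⊢
  have := (h1.ofReal (𝕜 := ℂ)).add ((h2.ofReal (𝕜 := ℂ)).mul_const Complex.I)
  refine this.congr (Eventually.of_forall fun x => ?_)
  simp [Complex.re_add_im]

theorem AbsolutelyContinuousOnInterval.complex_integral_eq_sub {f f' : ℝ → ℂ} {a b : ℝ}
    (hf : AbsolutelyContinuousOnInterval f a b)
    (h : ∀ᵐ x, x ∈ uIcc a b → HasDerivAt f (f' x) x) : ∫ x in a..b, f' x = f b - f a := by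
  have hi := hf.complex_intervalIntegrable h
  have h1 := hf.complex_re.integral_eq_sub_of_ae_hasDerivAt
    (h.mono fun x hx hm => (hx hm).complex_re)
  have h2 := hf.complex_im.integral_eq_sub_of_ae_hasDerivAt
    (h.mono fun x hx hm => (hx hm).complex_im)
  have e1 := Complex.reCLM.intervalIntegral_comp_comm hi
  have e2 := Complex.imCLM.intervalIntegral_comp_comm hi
  simp only [Complex.reCLM_apply, Complex.imCLM_apply] at e1 e2
  apply Complex.ext
  · rw [← e1, h1, Complex.sub_re]
  · rw [← e2, h2, Complex.sub_im]

/-- A function given on `[a, b]` as an indefinite integral is absolutely continuous. -/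
theorem absolutelyContinuousOnInterval_of_eq_add_integral {E : Type*} [NormedAddCommGroup E]
    [NormedSpace ℝ E] {f g : ℝ → E} {a b : ℝ} (hg : IntervalIntegrable g volume a b)
    (h : ∀ x ∈ uIcc a b, f x = f a + ∫ t in a..x, g t) : AbsolutelyContinuousOnInterval f a b := by
  refine (hg.absolutelyContinuousOnInterval_primitive left_mem_uIcc).of_dist_le (C := 1)
    fun x hx y hy => ?_
  rw [h x hx, h y hy, dist_add_left, one_mul]

/-- A function given on `[a, b]` as an indefinite integral has the integrand as a.e. derivative. -/
theorem ae_hasDerivAt_of_eq_add_integral {E : Type*} [NormedAddCommGroup E]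
    [NormedSpace ℝ E] [CompleteSpace E] {f g : ℝ → E} {a b : ℝ}
    (hg : IntervalIntegrable g volume a b) (hab : a ≤ b)
    (h : ∀ x ∈ uIcc a b, f x = f a + ∫ t in a..x, g t) :
    ∀ᵐ x, x ∈ uIcc a b → HasDerivAt f (g x) x := by
  -- The endpoints are discarded: the integral formula is known only inside `[a, b]`, so it gives no
  -- two-sided derivative there.
  have ha : ∀ᵐ x : ℝ, x ≠ a := by simp [ae_iff, measure_singleton]
  have hb : ∀ᵐ x : ℝ, x ≠ b := by simp [ae_iff, measure_singleton]
  filter_upwards [hg.ae_hasDerivAt_integral, ha, hb] with x hx hxa hxb hxm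
  have hd := (hx hxm a left_mem_uIcc).const_add (f a)
  refine hd.congr_of_eventuallyEq ?_
  rw [uIcc_of_le hab] at hxm h
  filter_upwards [Icc_mem_nhds (lt_of_le_of_ne hxm.1 (Ne.symm hxa)) (lt_of_le_of_ne hxm.2 hxb)]
    with y hy using h y hy

/-! ### Weak derivatives on an interval -/

/-- A compact subset of an open set of reals lies strictly between two points of that set. -/
theorem IsCompact.exists_subset_Ioo_of_isOpen {I K : Set ℝ} (hI : IsOpen I)
    (hne : I.Nonempty) (hK : IsCompact K) (hKI : K ⊆ I) :
    ∃ p ∈ I, ∃ q ∈ I, p < q ∧ K ⊆ Ioo p q := by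
  have key : ∀ x ∈ I, ∃ p ∈ I, ∃ q ∈ I, p < x ∧ x < q := fun x hx => by
    obtain ⟨l, u, hlu, hs⟩ := mem_nhds_iff_exists_Ioo_subset.1 (hI.mem_nhds hx)
    obtain ⟨p, hp⟩ := exists_between hlu.1
    obtain ⟨q, hq⟩ := exists_between hlu.2
    exact ⟨p, hs ⟨hp.1, hp.2.trans hlu.2⟩, q, hs ⟨hlu.1.trans hq.1, hq.2⟩, hp.2, hq.1⟩
  rcases K.eq_empty_or_nonempty with rfl | hKn
  · obtain ⟨x, hx⟩ := hne
    obtain ⟨p, hp, q, hq, h1, h2⟩ := key x hx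
    exact ⟨p, hp, q, hq, h1.trans h2, empty_subset _⟩
  · obtain ⟨m, hm, hmin⟩ := hK.exists_isLeast hKn
    obtain ⟨M, hM, hmax⟩ := hK.exists_isGreatest hKn
    obtain ⟨p, hp, -, -, h1, -⟩ := key m (hKI hm)
    obtain ⟨-, -, q, hq, -, h2⟩ := key M (hKI hM)
    exact ⟨p, hp, q, hq, (h1.trans_le (hmin hM)).trans h2,
      fun x hx => ⟨h1.trans_le (hmin hx), (hmax hx).trans_lt h2⟩⟩

/-- The integral of a function supported in a subinterval. -/
theorem setIntegral_eq_intervalIntegral_of_eq_zero {E : Type*} [NormedAddCommGroup E]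
    [NormedSpace ℝ E] {I : Set ℝ} (hc : I.OrdConnected) {p q : ℝ} (hp : p ∈ I) (hq : q ∈ I)
    (hpq : p ≤ q) {F : ℝ → E} (hF : ∀ x, x ∉ Ioo p q → F x = 0) :
    ∫ x in I, F x = ∫ x in p..q, F x := by
  rw [intervalIntegral.integral_of_le hpq,
    setIntegral_eq_of_subset_of_forall_sdiff_eq_zero hc.measurableSet
      (Ioc_subset_Icc_self.trans (hc.out hp hq))
      fun x hx => hF x fun h => hx.2 (Ioo_subset_Ioc_self h)]

theorem MeasureTheory.LocallyIntegrableOn.intervalIntegrable {E : Type*} [NormedAddCommGroup E]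
    {I : Set ℝ} (hc : I.OrdConnected) {f : ℝ → E} (hf : LocallyIntegrableOn f I) {p q : ℝ}
    (hp : p ∈ I) (hq : q ∈ I) : IntervalIntegrable f volume p q :=
  (hf.integrableOn_compact_subset (hc.uIcc_subset hp hq) isCompact_uIcc).intervalIntegrable

/-- A locally absolutely continuous function has its a.e. derivative as weak derivative. -/
theorem hasWeakDerivOn_of_absolutelyContinuous {I : Set ℝ} (hI : IsOpen I) (hc : I.OrdConnected)
    {f g : ℝ → ℂ} (hf : LocallyIntegrableOn f I) (hg : LocallyIntegrableOn g I)
    (hac : ∀ x ∈ I, ∀ y ∈ I, AbsolutelyContinuousOnInterval f x y)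
    (hd : ∀ᵐ x, x ∈ I → HasDerivAt f (g x) x) : HasWeakDerivOn I f g := by
  refine ⟨hf, hg, fun φ hφ hs hsI => ?_⟩
  rcases I.eq_empty_or_nonempty with rfl | hne
  · simp
  obtain ⟨p, hp, q, hq, hpq, hK⟩ := hs.isCompact.exists_subset_Ioo_of_isOpen hI hne hsI
  have hz : ∀ x, x ∉ Ioo p q → φ x = 0 := fun x hx =>
    image_eq_zero_of_notMem_tsupport fun h => hx (hK h)
  have hz' : ∀ x, x ∉ Ioo p q → deriv φ x = 0 := fun x hx =>
    image_eq_zero_of_notMem_tsupport fun h => hx (hK (tsupport_deriv_subset h))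
  have hφc : Continuous (deriv φ) := hφ.continuous_deriv (by simp)
  rw [setIntegral_eq_intervalIntegral_of_eq_zero hc hp hq hpq.le
      (fun x hx => by rw [hz' x hx, zero_smul]),
    setIntegral_eq_intervalIntegral_of_eq_zero hc hp hq hpq.le
      (fun x hx => by rw [hz x hx, zero_smul]), eq_neg_iff_add_eq_zero,
    ← intervalIntegral.integral_add]
  -- The two integrals add up to that of `(φ f)'`, and `φ f` vanishes at `p` and `q`.
  · have hφac : AbsolutelyContinuousOnInterval φ p q :=
      (hφ.of_le (by simp)).contDiffOn.absolutelyContinuousOnInterval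
    have := (hφac.fun_smul (hac p hp q hq)).complex_integral_eq_sub
      (f' := fun x => deriv φ x • f x + φ x • g x) (by
        filter_upwards [hd] with x hx hxm
        have h1 := ((hφ.differentiable (by simp)) x).hasDerivAt.smul
          (hx (hc.uIcc_subset hp hq hxm))
        rw [add_comm]
        exact h1)
    rw [this, hz p (by simp), hz q (by simp), zero_smul, zero_smul, sub_zero]
  · exact (hf.intervalIntegrable hc hp hq).continuousOn_smul hφc.continuousOn
  · exact (hg.intervalIntegrable hc hp hq).continuousOn_smul hφ.continuous.continuousOn

theorem MeasureTheory.LocallyIntegrableOn.integrable_smul_of_hasCompactSupport {I : Set ℝ}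
    {G : ℝ → ℂ} (hG : LocallyIntegrableOn G I) {φ : ℝ → ℝ} (hφ : Continuous φ)
    (hs : HasCompactSupport φ) (hsI : tsupport φ ⊆ I) : Integrable (fun x => φ x • G x) := by
  refine (integrableOn_iff_integrable_of_support_subset (s := tsupport φ) ?_).1 ?_
  · exact (Function.support_smul_subset_left φ G).trans (subset_tsupport φ)
  · exact (hG.integrableOn_compact_subset hsI hs.isCompact).continuousOn_smul
      hφ.continuousOn hs.isCompact

theorem HasWeakDerivOn.sub {I : Set ℝ} {f g f' g' : ℝ → ℂ} (h : HasWeakDerivOn I f f')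
    (h' : HasWeakDerivOn I g g') : HasWeakDerivOn I (f - g) (f' - g') := by
  refine ⟨h.1.sub h'.1, h.2.1.sub h'.2.1, fun φ hφ hs hsI => ?_⟩
  have hd : Continuous (deriv φ) := hφ.continuous_deriv (by simp)
  have hdI : tsupport (deriv φ) ⊆ I := tsupport_deriv_subset.trans hsI
  simp only [Pi.sub_apply, smul_sub]
  rw [integral_sub (h.1.integrable_smul_of_hasCompactSupport hd hs.deriv hdI).integrableOn
      (h'.1.integrable_smul_of_hasCompactSupport hd hs.deriv hdI).integrableOn,
    integral_sub (h.2.1.integrable_smul_of_hasCompactSupport hφ.continuous hs hsI).integrableOn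
      (h'.2.1.integrable_smul_of_hasCompactSupport hφ.continuous hs hsI).integrableOn,
    h.2.2 φ hφ hs hsI, h'.2.2 φ hφ hs hsI]
  ring

theorem HasWeakDerivOn.mono {I J : Set ℝ} (hIm : MeasurableSet I) (hJ : J ⊆ I) {f g : ℝ → ℂ}
    (h : HasWeakDerivOn I f g) : HasWeakDerivOn J f g := by
  refine ⟨h.1.mono_set hJ, h.2.1.mono_set hJ, fun φ hφ hs hsJ => ?_⟩
  have hz : ∀ x ∈ I \ J, φ x = 0 := fun x hx =>
    image_eq_zero_of_notMem_tsupport fun h => hx.2 (hsJ h)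
  have hz' : ∀ x ∈ I \ J, deriv φ x = 0 := fun x hx =>
    image_eq_zero_of_notMem_tsupport fun h => hx.2 (hsJ (tsupport_deriv_subset h))
  rw [← setIntegral_eq_of_subset_of_forall_sdiff_eq_zero hIm hJ
      (fun x hx => by rw [hz' x hx, zero_smul]),
    ← setIntegral_eq_of_subset_of_forall_sdiff_eq_zero hIm hJ
      (fun x hx => by rw [hz x hx, zero_smul])]
  exact h.2.2 φ hφ hs (hsJ.trans hJ)

/-- Weak derivatives are unique up to null sets. -/
theorem HasWeakDerivOn.ae_eq {I : Set ℝ} (hI : IsOpen I) {f g g' : ℝ → ℂ}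
    (h : HasWeakDerivOn I f g) (h' : HasWeakDerivOn I f g') :
    g =ᵐ[volume.restrict I] g' := by
  rw [EventuallyEq, ae_restrict_iff' hI.measurableSet]
  have := hI.ae_eq_zero_of_integral_contDiff_smul_eq_zero (μ := volume) (h.2.1.sub h'.2.1)
    fun φ hφ hs hsI => by
      have hφz : ∀ x, x ∉ I → φ x = 0 := fun x hx =>
        image_eq_zero_of_notMem_tsupport fun h => hx (hsI h)
      have e : ∀ G : ℝ → ℂ, ∫ x in I, φ x • G x = ∫ x, φ x • G x := fun G =>
        setIntegral_eq_integral_of_forall_compl_eq_zero fun x hx => by rw [hφz x hx, zero_smul]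
      have h1 := h.2.2 φ hφ hs hsI
      rw [h'.2.2 φ hφ hs hsI, neg_inj, e, e] at h1
      simp only [Pi.sub_apply, smul_sub]
      rw [integral_sub (h.2.1.integrable_smul_of_hasCompactSupport hφ.continuous hs hsI)
        (h'.2.1.integrable_smul_of_hasCompactSupport hφ.continuous hs hsI), h1, sub_self]
  filter_upwards [this] with x hx hxm using sub_eq_zero.1 (hx hxm)

/-- Allows the representative picked by choice to be replaced by an explicit derivative under
integrals. -/
theorem HasWeakDerivOn.weakDerivOn_ae_eq {I : Set ℝ} (hI : IsOpen I) {f g : ℝ → ℂ}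
    (h : HasWeakDerivOn I f g) : weakDerivOn I f =ᵐ[volume.restrict I] g := by
  have he : ∃ g, HasWeakDerivOn I f g := ⟨g, h⟩
  rw [weakDerivOn, dif_pos he]
  exact he.choose_spec.ae_eq hI h

/-- The lemma of du Bois-Reymond: a continuous function with vanishing weak derivative on an
interval is constant. -/
theorem HasWeakDerivOn.exists_eq_const {I : Set ℝ} (hI : IsOpen I) (hc : I.OrdConnected)
    {f : ℝ → ℂ} (hf : ContinuousOn f I) (h : HasWeakDerivOn I f 0) : ∃ C, ∀ x ∈ I, f x = C := by
  rcases I.eq_empty_or_nonempty with rfl | ⟨x₀, hx₀⟩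
  · simp
  obtain ⟨r, hr, hrI⟩ := Metric.isOpen_iff.1 hI x₀ hx₀
  let b : ContDiffBump x₀ := ⟨r / 3, r / 2, by positivity, by linarith⟩
  let η : ℝ → ℝ := b.normed volume
  have hηs : ContDiff ℝ ∞ η := b.contDiff_normed
  have hηc : HasCompactSupport η := b.hasCompactSupport_normed
  have hηt : tsupport η ⊆ I := by
    rw [b.tsupport_normed_eq]
    exact (Metric.closedBall_subset_ball (by simp [b]; linarith)).trans hrI
  have hη1 : ∫ x, η x = 1 := b.integral_normed
  -- If `f` is constant, averaging it against a bump of mass one recovers the constant.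
  refine ⟨∫ x in I, η x • f x, ?_⟩
  set C := ∫ x in I, η x • f x with hC
  have hloc : LocallyIntegrableOn (fun x => f x - C) I :=
    h.1.sub (continuousOn_const.locallyIntegrableOn hI.measurableSet)
  have hae := hI.ae_eq_zero_of_integral_contDiff_smul_eq_zero (μ := volume) hloc
    fun ψ hψ hs hsI => by
      -- Subtracting `m η` makes the mean of `ψ` zero, so the primitive `φ` of the difference is
      -- again a test function. Testing `f' = 0` against `φ` gives `∫ ψ f = m C`.
      let m := ∫ x, ψ x
      let F : ℝ → ℝ := fun x => ψ x - m * η x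
      have hF : ContDiff ℝ ∞ F := hψ.sub (contDiff_const.mul hηs)
      obtain ⟨p, hp, q, hq, hpq, hK⟩ := (hs.isCompact.union
        hηc.isCompact).exists_subset_Ioo_of_isOpen hI ⟨x₀, hx₀⟩ (union_subset hsI hηt)
      have hψz : ∀ x, x ∉ Ioo p q → ψ x = 0 := fun x hx =>
        image_eq_zero_of_notMem_tsupport fun h => hx (hK (Or.inl h))
      have hηz : ∀ x, x ∉ Ioo p q → η x = 0 := fun x hx =>
        image_eq_zero_of_notMem_tsupport fun h => hx (hK (Or.inr h))
      have hFz : ∀ x, x ∉ Ioo p q → F x = 0 := fun x hx => by simp [F, hψz x hx, hηz x hx]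
      let φ : ℝ → ℝ := fun x => ∫ t in p..x, F t
      have hφd : ∀ x, HasDerivAt φ (F x) x := fun x =>
        intervalIntegral.integral_hasDerivAt_right (hF.continuous.intervalIntegrable _ _)
          (hF.continuous.stronglyMeasurableAtFilter _ _) hF.continuous.continuousAt
      have hφd' : deriv φ = F := funext fun x => (hφd x).deriv
      have hφs : ContDiff ℝ ∞ φ := by
        rw [contDiff_infty_iff_deriv, hφd']
        exact ⟨fun x => (hφd x).differentiableAt, hF⟩
      have htot : ∫ t in p..q, F t = 0 := by
        rw [← setIntegral_eq_intervalIntegral_of_eq_zero (I := univ) ordConnected_univ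
          (mem_univ p) (mem_univ q) hpq.le hFz, setIntegral_univ,
          integral_sub (hψ.continuous.integrable_of_hasCompactSupport hs)
            ((hηs.continuous.integrable_of_hasCompactSupport hηc).const_mul m),
          integral_const_mul, hη1, mul_one, sub_self]
      have hφz : ∀ x, x ∉ Icc p q → φ x = 0 := by
        intro x hx
        rcases lt_or_ge x p with hxp | hxp
        · refine intervalIntegral.integral_zero_ae (Eventually.of_forall fun t ht => hFz t ?_)
          rw [uIoc_of_ge hxp.le] at ht
          exact fun h => (h.1.trans_le ht.2).false
        · have hxq : q < x := by
            by_contra hcon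
            exact hx ⟨hxp, not_lt.1 hcon⟩
          have : φ x = (∫ t in p..q, F t) + ∫ t in q..x, F t :=
            (intervalIntegral.integral_add_adjacent_intervals
              (hF.continuous.intervalIntegrable _ _) (hF.continuous.intervalIntegrable _ _)).symm
          rw [this, htot, zero_add]
          refine intervalIntegral.integral_zero_ae (Eventually.of_forall fun t ht => hFz t ?_)
          rw [uIoc_of_le hxq.le] at ht
          exact fun h => (h.2.trans ht.1).false
      have hφt : tsupport φ ⊆ Icc p q :=
        closure_minimal (fun x hx => by_contra fun hn => hx (hφz x hn)) isClosed_Icc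
      have hφc : HasCompactSupport φ := isCompact_Icc.of_isClosed_subset (isClosed_tsupport φ) hφt
      have h0 := h.2.2 φ hφs hφc (hφt.trans (hc.out hp hq))
      simp only [Pi.zero_apply, smul_zero, integral_zero, neg_zero, hφd'] at h0
      have hfi := h.1.intervalIntegrable hc hp hq
      have hψf : IntervalIntegrable (fun x => ψ x • f x) volume p q :=
        hfi.continuousOn_smul hψ.continuous.continuousOn
      have hηf : IntervalIntegrable (fun x => η x • f x) volume p q :=
        hfi.continuousOn_smul hηs.continuous.continuousOn
      have hηm : IntervalIntegrable (fun x => m • η x • f x) volume p q := hηf.smul m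
      have hCi : C = ∫ x in p..q, η x • f x :=
        setIntegral_eq_intervalIntegral_of_eq_zero hc hp hq hpq.le
          fun x hx => by rw [hηz x hx, zero_smul]
      have hm : m = ∫ x in p..q, ψ x := by
        rw [← setIntegral_eq_intervalIntegral_of_eq_zero (I := univ) ordConnected_univ
          (mem_univ p) (mem_univ q) hpq.le hψz, setIntegral_univ]
      rw [setIntegral_eq_intervalIntegral_of_eq_zero hc hp hq hpq.le
        (fun x hx => by rw [hFz x hx, zero_smul])] at h0
      rw [← setIntegral_univ, setIntegral_eq_intervalIntegral_of_eq_zero (I := univ)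
        ordConnected_univ (mem_univ p) (mem_univ q) hpq.le
        (fun x hx => by rw [hψz x hx, zero_smul])]
      have hψc : Continuous fun x => ψ x • C := hψ.continuous.smul continuous_const
      simp only [smul_sub]
      rw [intervalIntegral.integral_sub hψf
        (hψc.intervalIntegrable _ _),
        intervalIntegral.integral_smul_const, ← hm]
      simp only [F, sub_smul, mul_smul] at h0
      rw [intervalIntegral.integral_sub hψf hηm, intervalIntegral.integral_smul,
        ← hCi] at h0
      exact h0
  have heq : f =ᵐ[volume.restrict I] fun _ => C := by
    rw [EventuallyEq, ae_restrict_iff' hI.measurableSet]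
    filter_upwards [hae] with x hx hxm using sub_eq_zero.1 (hx hxm)
  exact Measure.eqOn_open_of_ae_eq heq hI hf continuousOn_const

/-- A continuous function on an interval is an indefinite integral of its weak derivative. -/
theorem HasWeakDerivOn.eq_add_integral {I : Set ℝ} (hI : IsOpen I) (hc : I.OrdConnected)
    {f g : ℝ → ℂ} (hf : ContinuousOn f I) (h : HasWeakDerivOn I f g) {x y : ℝ} (hx : x ∈ I)
    (hy : y ∈ I) : f y = f x + ∫ t in x..y, g t := by
  obtain ⟨p, hp, q, hq, hpq, hK⟩ := (isCompact_singleton.union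
    isCompact_singleton).exists_subset_Ioo_of_isOpen hI ⟨x, hx⟩
      (union_subset (singleton_subset_iff.2 hx) (singleton_subset_iff.2 hy))
  have hx' : x ∈ Ioo p q := hK (Or.inl rfl)
  have hy' : y ∈ Ioo p q := hK (Or.inr rfl)
  have hpqI : Ioo p q ⊆ I := Ioo_subset_Icc_self.trans (hc.out hp hq)
  -- The primitive `G` has the same weak derivative as `f`, so `f - G` is constant by du
  -- Bois-Reymond.
  let G : ℝ → ℂ := fun z => ∫ t in p..z, g t
  have hi : IntervalIntegrable g volume p q := h.2.1.intervalIntegrable hc hp hq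
  have hG : ∀ z ∈ uIcc p q, G z = G p + ∫ t in p..z, g t := fun z _ => by simp [G]
  have hac := absolutelyContinuousOnInterval_of_eq_add_integral hi hG
  have hsub : Ioo p q ⊆ uIcc p q := (uIcc_of_le hpq.le).symm ▸ Ioo_subset_Icc_self
  have hGc : ContinuousOn G (Ioo p q) := hac.continuousOn.mono hsub
  have hGd : HasWeakDerivOn (Ioo p q) G g := by
    refine hasWeakDerivOn_of_absolutelyContinuous isOpen_Ioo ordConnected_Ioo
      (hGc.locallyIntegrableOn measurableSet_Ioo) (h.2.1.mono_set hpqI)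
      (fun u hu v hv => hac.mono (uIcc_subset_uIcc (hsub hu) (hsub hv))) ?_
    filter_upwards [ae_hasDerivAt_of_eq_add_integral hi hpq.le hG] with z hz hzm
      using hz (hsub hzm)
  have h0 : HasWeakDerivOn (Ioo p q) (f - G) 0 := by
    simpa using (h.mono hI.measurableSet hpqI).sub hGd
  obtain ⟨C, hC⟩ := h0.exists_eq_const isOpen_Ioo ordConnected_Ioo ((hf.mono hpqI).sub hGc)
  have h1 := hC x hx'
  have h2 := hC y hy'
  have h3 : G x + ∫ t in x..y, g t = G y := intervalIntegral.integral_add_adjacent_intervals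
    (hi.mono_set (uIcc_subset_uIcc left_mem_uIcc (hsub hx')))
    (hi.mono_set (uIcc_subset_uIcc (hsub hx') (hsub hy')))
  rw [Pi.sub_apply] at h1 h2
  linear_combination h2 - h1 - h3

/-- A function that is continuous on `[a, b]` is an indefinite integral of its weak derivative on
`(a, b)` if the latter is integrable. -/
theorem HasWeakDerivOn.eq_add_integral_Icc {a b : ℝ} (hab : a < b) {f g : ℝ → ℂ}
    (hf : ContinuousOn f (Icc a b)) (h : HasWeakDerivOn (Ioo a b) f g)
    (hg : IntervalIntegrable g volume a b) : ∀ x ∈ uIcc a b, f x = f a + ∫ t in a..x, g t := by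
  rw [uIcc_of_le hab.le]
  have hG : ContinuousOn (fun x => ∫ t in a..x, g t) (Icc a b) := by
    rw [← uIcc_of_le hab.le]
    exact (hg.absolutelyContinuousOnInterval_primitive left_mem_uIcc).continuousOn
  have hi : ∀ z ∈ Icc a b, IntervalIntegrable g volume a z := fun z hz =>
    hg.mono_set (uIcc_subset_uIcc left_mem_uIcc ((uIcc_of_le hab.le).symm ▸ hz))
  have hm : (a + b) / 2 ∈ Ioo a b := ⟨by linarith, by linarith⟩
  set m := (a + b) / 2
  have hEq : EqOn (fun x => f x - ∫ t in a..x, g t) (fun _ => f m - ∫ t in a..m, g t)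
      (Icc a b) := by
    refine EqOn.of_subset_closure (s := Ioo a b) (fun x hx => ?_) (hf.sub hG) continuousOn_const
      Ioo_subset_Icc_self (closure_Ioo hab.ne).ge
    have h1 := h.eq_add_integral isOpen_Ioo ordConnected_Ioo (hf.mono Ioo_subset_Icc_self) hm hx
    have h2 := intervalIntegral.integral_interval_sub_left (hi x (Ioo_subset_Icc_self hx))
      (hi m (Ioo_subset_Icc_self hm))
    linear_combination h1 - h2
  intro x hx
  have h1 := hEq hx
  have h2 := hEq (left_mem_Icc.2 hab.le)
  simp only [intervalIntegral.integral_same, sub_zero] at h1 h2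
  linear_combination h1 - h2

namespace LoopGraph

/-! ### Completing the square on the circle -/

/-- `tan (k (θ - π))`, minus the logarithmic derivative of the ground state on the circle,
divided by `k`. -/
noncomputable def circleTan (k θ : ℝ) : ℝ := Real.tan (k * (θ - Real.pi))

/-- The reciprocal of the ground state `cos (k (θ - π))`. -/
noncomputable def circleSec (k θ : ℝ) : ℝ := (Real.cos (k * (θ - Real.pi)))⁻¹

/-- The first order expression whose square completes the energy on the circle. -/
noncomputable def circleRemainder (k : ℝ) (c : ℂ) (v g : ℝ → ℂ) (θ : ℝ) : ℂ :=
  g θ + (k * circleTan k θ : ℝ) * v θ - (circleSec k θ : ℝ) * c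

/-- The boundary expression that appears when the square is completed on the circle. -/
noncomputable def circleBoundary (k : ℝ) (c : ℂ) (v : ℝ → ℂ) (θ : ℝ) : ℝ :=
  -(k * circleTan k θ) * ((v θ).re * (v θ).re + (v θ).im * (v θ).im)
    + circleSec k θ * (2 * c.re * (v θ).re + 2 * c.im * (v θ).im)
    - (c.re * c.re + c.im * c.im) / k * circleTan k θ

/-- Here `|k(θ-π)| ≤ kπ < π/2`. The bound `k < 1/2` is what keeps tangent and secant smooth on the
closed circle edge. -/
theorem cos_mul_sub_pi_pos {k θ : ℝ} (hk : 0 < k) (hk2 : k < 1 / 2)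
    (hθ : θ ∈ Icc 0 (2 * Real.pi)) : 0 < Real.cos (k * (θ - Real.pi)) := by
  have hπ := Real.pi_pos
  refine Real.cos_pos_of_mem_Ioo ⟨?_, ?_⟩
  · nlinarith [hθ.1, hθ.2, mul_nonneg hk.le hθ.1]
  · nlinarith [mul_nonneg hk.le (sub_nonneg.2 hθ.2)]

theorem hasDerivAt_circleTan {k θ : ℝ} (h : Real.cos (k * (θ - Real.pi)) ≠ 0) :
    HasDerivAt (circleTan k) (k * circleSec k θ ^ 2) θ := by
  have h1 : HasDerivAt (fun θ : ℝ => k * (θ - Real.pi)) (k * 1) θ :=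
    ((hasDerivAt_id θ).sub_const _).const_mul k
  refine ((Real.hasDerivAt_tan h).comp θ h1).congr_deriv ?_
  rw [circleSec]; field_simp

theorem hasDerivAt_circleSec {k θ : ℝ} (h : Real.cos (k * (θ - Real.pi)) ≠ 0) :
    HasDerivAt (circleSec k) (k * circleSec k θ * circleTan k θ) θ := by
  have h1 : HasDerivAt (fun θ : ℝ => k * (θ - Real.pi)) (k * 1) θ :=
    ((hasDerivAt_id θ).sub_const _).const_mul k
  refine (((Real.hasDerivAt_cos _).comp θ h1).inv h).congr_deriv ?_
  rw [circleSec, circleTan, Real.tan_eq_sin_div_cos]; simp only [Function.comp]; field_simp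

theorem contDiffOn_circleTan {k : ℝ} (hk : 0 < k) (hk2 : k < 1 / 2) :
    ContDiffOn ℝ 1 (circleTan k) (uIcc 0 (2 * Real.pi)) := by
  rw [uIcc_of_le Real.two_pi_pos.le]
  intro θ hθ
  have h : ContDiffAt ℝ 1 (fun θ : ℝ => k * (θ - Real.pi)) θ := by fun_prop
  exact ((Real.contDiffAt_tan.2 (cos_mul_sub_pi_pos hk hk2 hθ).ne').comp θ h).contDiffWithinAt

theorem contDiffOn_circleSec {k : ℝ} (hk : 0 < k) (hk2 : k < 1 / 2) :
    ContDiffOn ℝ 1 (circleSec k) (uIcc 0 (2 * Real.pi)) := by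
  rw [uIcc_of_le Real.two_pi_pos.le]
  intro θ hθ
  have h : ContDiffAt ℝ 1 (fun θ : ℝ => Real.cos (k * (θ - Real.pi))) θ := by fun_prop
  exact (h.inv (cos_mul_sub_pi_pos hk hk2 hθ).ne').contDiffWithinAt

theorem absolutelyContinuousOnInterval_circleBoundary {k : ℝ} (hk : 0 < k) (hk2 : k < 1 / 2)
    (c : ℂ) {v : ℝ → ℂ} (hv : AbsolutelyContinuousOnInterval v 0 (2 * Real.pi)) :
    AbsolutelyContinuousOnInterval (circleBoundary k c v) 0 (2 * Real.pi) := by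
  have ht := (contDiffOn_circleTan hk hk2).absolutelyContinuousOnInterval
  have hs := (contDiffOn_circleSec hk hk2).absolutelyContinuousOnInterval
  have hr := hv.complex_re
  have hi := hv.complex_im
  exact (((ht.const_mul k).fun_neg.fun_mul ((hr.fun_mul hr).fun_add (hi.fun_mul hi))).fun_add
    (hs.fun_mul ((hr.const_mul _).fun_add (hi.const_mul _)))).fun_sub (ht.const_mul _)

/-- Pointwise completion of the square on the circle. -/
theorem hasDerivAt_circleBoundary {k θ : ℝ} (hk : k ≠ 0) (h : Real.cos (k * (θ - Real.pi)) ≠ 0)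
    (c : ℂ) {v g : ℝ → ℂ} (hv : HasDerivAt v (g θ) θ) :
    HasDerivAt (circleBoundary k c v)
      (‖g θ‖ ^ 2 - k ^ 2 * ‖v θ‖ ^ 2 - ‖circleRemainder k c v g θ‖ ^ 2) θ := by
  have ht := hasDerivAt_circleTan h
  have hs := hasDerivAt_circleSec h
  have hr := hv.complex_re
  have hi := hv.complex_im
  have key := (((ht.const_mul k).fun_neg.fun_mul ((hr.fun_mul hr).fun_add (hi.fun_mul hi))).fun_add
    (hs.fun_mul ((hr.const_mul (2 * c.re)).fun_add (hi.const_mul (2 * c.im))))).fun_sub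
      (ht.const_mul ((c.re * c.re + c.im * c.im) / k))
  refine key.congr_deriv ?_
  -- This is the Riccati equation of the logarithmic derivative `-k tan`; everything else is the
  -- expansion of the square.
  have hst : circleSec k θ ^ 2 = 1 + circleTan k θ ^ 2 := by
    rw [circleSec, circleTan, Real.tan_eq_sin_div_cos]
    field_simp
    linarith [Real.sin_sq_add_cos_sq (k * (θ - Real.pi))]
  have hc : (c.re * c.re + c.im * c.im) / k * (k * circleSec k θ ^ 2) =
      (c.re * c.re + c.im * c.im) * circleSec k θ ^ 2 := by field_simp
  rw [hc]
  simp only [Complex.sq_norm, Complex.normSq_apply, circleRemainder, Complex.sub_re, Complex.add_re,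
    Complex.sub_im, Complex.add_im, Complex.re_ofReal_mul, Complex.im_ofReal_mul]
  linear_combination (-k ^ 2 * ((v θ).re ^ 2 + (v θ).im ^ 2)) * hst

/-- Completion of the square on the circle. -/
theorem integral_circle_eq {k : ℝ} (hk : 0 < k) (hk2 : k < 1 / 2) (c : ℂ) {v g : ℝ → ℂ}
    (hv : AbsolutelyContinuousOnInterval v 0 (2 * Real.pi))
    (hd : ∀ᵐ x, x ∈ uIcc 0 (2 * Real.pi) → HasDerivAt v (g x) x) :
    ∫ θ in 0..2 * Real.pi, (‖g θ‖ ^ 2 - k ^ 2 * ‖v θ‖ ^ 2 - ‖circleRemainder k c v g θ‖ ^ 2) =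
      circleBoundary k c v (2 * Real.pi) - circleBoundary k c v 0 := by
  refine (absolutelyContinuousOnInterval_circleBoundary hk hk2
    c hv).integral_eq_sub_of_ae_hasDerivAt ?_
  filter_upwards [hd] with x hx hxm
  have hxm' := hxm
  rw [uIcc_of_le Real.two_pi_pos.le] at hxm'
  exact hasDerivAt_circleBoundary hk.ne' (cos_mul_sub_pi_pos hk hk2 hxm').ne' c (hx hxm)

/-- The boundary terms on the circle for quasiperiodic boundary values: they are positive and
compensate the boundary term of the half-line. -/
theorem circleBoundary_sub {k γ s : ℝ} (hk : 0 < k) (hk2 : k < 1 / 2) {p q c : ℂ} (hq : ‖q‖ = 1)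
    (hs : q.re = s) (hroot : s = Real.cos (2 * Real.pi * k) -
      γ / (2 * k) * Real.sin (2 * Real.pi * k))
    (hc : c = ((k / (2 * Real.sin (k * Real.pi)) : ℝ) : ℂ) * ((q - 1) * p)) {v : ℝ → ℂ}
    (h0 : v 0 = p) (h1 : v (2 * Real.pi) = q * p) :
    circleBoundary k c v (2 * Real.pi) - circleBoundary k c v 0 = γ * ‖p‖ ^ 2 := by
  have hπ := Real.pi_pos
  have hsin : 0 < Real.sin (k * Real.pi) := Real.sin_pos_of_pos_of_lt_pi (by positivity)
    (by nlinarith)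
  have hcos : 0 < Real.cos (k * Real.pi) := Real.cos_pos_of_mem_Ioo
    ⟨by nlinarith, by nlinarith⟩
  have e0 : k * (0 - Real.pi) = -(k * Real.pi) := by ring
  have e1 : k * (2 * Real.pi - Real.pi) = k * Real.pi := by ring
  have e2 : 2 * Real.pi * k = 2 * (k * Real.pi) := by ring
  have hq2 : q.re ^ 2 + q.im ^ 2 = 1 := by
    have := Complex.sq_norm q
    rw [hq, Complex.normSq_apply] at this
    linarith
  -- In half-angle form both the root equation and the boundary terms are rational in the sine and
  -- cosine of `kπ`. The phase enters only through `Re q` and `|q| = 1`.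
  rw [e2, Real.sin_two_mul, Real.cos_two_mul] at hroot
  have hsc := Real.sin_sq_add_cos_sq (k * Real.pi)
  simp only [circleBoundary, circleTan, circleSec, h0, h1, e0, e1, Real.sin_neg, Real.cos_neg,
    Real.tan_eq_sin_div_cos, hc, Complex.sq_norm, Complex.normSq_apply, Complex.ofReal_re,
    Complex.ofReal_im, Complex.mul_re, Complex.mul_im, Complex.sub_re, Complex.sub_im,
    Complex.one_re, Complex.one_im, sub_zero]
  rw [← hs] at hroot
  set S := Real.sin (k * Real.pi)
  set D := Real.cos (k * Real.pi)
  have hγ : γ * (S * D) = k * (2 * D ^ 2 - 1 - q.re) := by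
    rw [hroot]; field_simp; ring
  obtain ⟨a, b⟩ := q
  obtain ⟨x, y⟩ := p
  simp only at hγ hq2 ⊢
  have hγ' : γ = k * (2 * D ^ 2 - 1 - a) / (S * D) := by
    rw [← hγ]; field_simp
  rw [hγ']
  field_simp
  linear_combination (4 * k ^ 2 * (x ^ 2 + y ^ 2)) * ((1 / 2 - S ^ 2) * hq2 - 2 * hsc)

/-! ### Completing the square on the half-line -/

/-- The first order expression whose square completes the energy on the half-line. -/
noncomputable def rayRemainder (γ : ℝ) (f g : ℝ → ℂ) (r : ℝ) : ℂ := g r - ((γ * r⁻¹ : ℝ) : ℂ) * f r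

/-- Pointwise completion of the square on the half-line. -/
theorem hasDerivAt_rayBoundary {γ r : ℝ} (hr : r ≠ 0) {f g : ℝ → ℂ} (hf : HasDerivAt f (g r) r) :
    HasDerivAt (fun r => γ * r⁻¹ * ((f r).re * (f r).re + (f r).im * (f r).im))
      (‖g r‖ ^ 2 - γ * (1 - γ) * ((r ^ 2)⁻¹ * ‖f r‖ ^ 2) - ‖rayRemainder γ f g r‖ ^ 2) r := by
  have h1 := hf.complex_re
  have h2 := hf.complex_im
  refine (((hasDerivAt_inv hr).const_mul γ).fun_mul
    ((h1.fun_mul h1).fun_add (h2.fun_mul h2))).congr_deriv ?_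
  simp only [Complex.sq_norm, Complex.normSq_apply, rayRemainder, Complex.sub_re, Complex.sub_im,
    Complex.re_ofReal_mul, Complex.im_ofReal_mul]
  field_simp
  ring

theorem memLp_inv_mul {f : ℝ → ℂ} (hf : MemLp f 2 (volume.restrict (Ioi 1))) (γ : ℝ) :
    MemLp (fun r => ((γ * r⁻¹ : ℝ) : ℂ) * f r) 2 (volume.restrict (Ioi 1)) := by
  refine hf.of_le_mul (c := |γ|) ?_ ?_
  · exact (by fun_prop : Measurable fun r : ℝ => ((γ * r⁻¹ : ℝ) : ℂ)).aestronglyMeasurable.mul hf.1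
  · refine (ae_restrict_iff' measurableSet_Ioi).2 (Eventually.of_forall fun r hr => ?_)
    have hr1 : (1 : ℝ) < r := hr
    have hr' : |r⁻¹| ≤ 1 := by
      rw [abs_inv, abs_of_pos (by linarith)]
      exact inv_le_one_of_one_le₀ hr1.le
    rw [norm_mul, Complex.norm_real, Real.norm_eq_abs, abs_mul]
    exact mul_le_mul_of_nonneg_right (mul_le_of_le_one_right (abs_nonneg _) hr') (norm_nonneg _)

theorem memLp_rayRemainder {f g : ℝ → ℂ} (hf : MemLp f 2 (volume.restrict (Ioi 1)))
    (hg : MemLp g 2 (volume.restrict (Ioi 1))) (γ : ℝ) :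
    MemLp (rayRemainder γ f g) 2 (volume.restrict (Ioi 1)) :=
  hg.sub (memLp_inv_mul hf γ)

theorem integrable_norm_sq {f : ℝ → ℂ} {μ : Measure ℝ} (hf : MemLp f 2 μ) :
    Integrable (fun r => ‖f r‖ ^ 2) μ := hf.integrable_norm_pow (by norm_num)

theorem integrableOn_inv_sq_mul {f : ℝ → ℂ} (hf : MemLp f 2 (volume.restrict (Ioi 1))) :
    IntegrableOn (fun r => (r ^ 2)⁻¹ * ‖f r‖ ^ 2) (Ioi 1) := by
  refine (integrable_norm_sq (memLp_inv_mul hf 1)).congr (Eventually.of_forall fun r => ?_)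
  simp [mul_pow]

/-- Completion of the square on the half-line. -/
theorem integral_ray_eq {f g : ℝ → ℂ} (hfc : ContinuousOn f (Ici 1))
    (hf : MemLp f 2 (volume.restrict (Ioi 1))) (hg : MemLp g 2 (volume.restrict (Ioi 1)))
    (hw : HasWeakDerivOn (Ioi 1) f g) (γ : ℝ) :
    ∫ r in Ioi 1, (‖g r‖ ^ 2 - γ * (1 - γ) * ((r ^ 2)⁻¹ * ‖f r‖ ^ 2) - ‖rayRemainder γ f g r‖ ^ 2) =
      -(γ * ‖f 1‖ ^ 2) := by
  let B : ℝ → ℝ := fun r => γ * r⁻¹ * ((f r).re * (f r).re + (f r).im * (f r).im)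
  have hBn : ∀ r, B r = γ * r⁻¹ * ‖f r‖ ^ 2 := fun r => by
    rw [Complex.sq_norm, Complex.normSq_apply]
  have hint : IntegrableOn (fun r => ‖g r‖ ^ 2 - γ * (1 - γ) * ((r ^ 2)⁻¹ * ‖f r‖ ^ 2) -
      ‖rayRemainder γ f g r‖ ^ 2) (Ioi 1) :=
    ((integrable_norm_sq hg).sub ((integrableOn_inv_sq_mul hf).const_mul _)).sub
      (integrable_norm_sq (memLp_rayRemainder hf hg γ))
  have hB : ∀ R : ℝ, 1 < R → ∫ r in 1..R, (‖g r‖ ^ 2 - γ * (1 - γ) * ((r ^ 2)⁻¹ * ‖f r‖ ^ 2) -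
      ‖rayRemainder γ f g r‖ ^ 2) = B R - B 1 := fun R hR => by
    have hgi : IntervalIntegrable g volume 1 R := by
      rw [intervalIntegrable_iff_integrableOn_Ioc_of_le hR.le]
      exact (hg.mono_measure (Measure.restrict_mono Ioc_subset_Ioi_self le_rfl)).integrable
        (by norm_num)
    have heq := (hw.mono measurableSet_Ioi Ioo_subset_Ioi_self).eq_add_integral_Icc hR
      (hfc.mono Icc_subset_Ici_self) hgi
    have hac := absolutelyContinuousOnInterval_of_eq_add_integral hgi heq
    have hinv : AbsolutelyContinuousOnInterval (fun r : ℝ => r⁻¹) 1 R := by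
      refine ContDiffOn.absolutelyContinuousOnInterval fun r hr => ?_
      rw [uIcc_of_le hR.le] at hr
      exact (contDiffAt_inv ℝ (by linarith [hr.1])).contDiffWithinAt
    have hr := hac.complex_re
    have hi := hac.complex_im
    refine ((hinv.const_mul γ).fun_mul ((hr.fun_mul hr).fun_add
      (hi.fun_mul hi))).integral_eq_sub_of_ae_hasDerivAt ?_
    filter_upwards [ae_hasDerivAt_of_eq_add_integral hgi hR.le heq] with r hr hrm
    have hrm' := hrm
    rw [uIcc_of_le hR.le] at hrm'
    exact hasDerivAt_rayBoundary (by linarith [hrm'.1]) (hr hrm)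
  have hlim := intervalIntegral_tendsto_integral_Ioi 1 hint tendsto_id
  set L := ∫ r in Ioi 1, (‖g r‖ ^ 2 - γ * (1 - γ) * ((r ^ 2)⁻¹ * ‖f r‖ ^ 2) -
      ‖rayRemainder γ f g r‖ ^ 2)
  -- The boundary term at `R` has a limit because the integral over the half-line converges. As `B`
  -- is also integrable near infinity, the limit must be zero.
  have hBlim : Tendsto B atTop (𝓝 (L + B 1)) := by
    refine (hlim.add_const (B 1)).congr' ?_
    filter_upwards [eventually_gt_atTop 1] with R hR
    rw [id, hB R hR, sub_add_cancel]
  have hBint : IntegrableOn B (Ioi 1) := by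
    refine ((integrable_norm_sq hf).const_mul |γ|).mono' ?_ ?_
    · refine (((by fun_prop : Measurable fun r : ℝ => γ * r⁻¹).aestronglyMeasurable.mul
        (integrable_norm_sq hf).1)).congr (Eventually.of_forall fun r => (hBn r).symm)
    · refine (ae_restrict_iff' measurableSet_Ioi).2 (Eventually.of_forall fun r hr => ?_)
      have hr1 : (1 : ℝ) < r := hr
      have hr' : |r⁻¹| ≤ 1 := by
        rw [abs_inv, abs_of_pos (by linarith)]
        exact inv_le_one_of_one_le₀ hr1.le
      rw [hBn, Real.norm_eq_abs, abs_mul, abs_mul, abs_of_nonneg (sq_nonneg ‖f r‖)]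
      exact mul_le_mul_of_nonneg_right (mul_le_of_le_one_right (abs_nonneg _) hr') (sq_nonneg _)
  have hz : L + B 1 = 0 := by
    have hfil : IntegrableAtFilter B atTop := ⟨Ioi 1, Ioi_mem_atTop _, hBint⟩
    refine hfil.eq_zero_of_tendsto (fun s hs => ?_) hBlim
    obtain ⟨b, hb⟩ := mem_atTop_sets.1 hs
    rw [← top_le_iff, ← Real.volume_Ici (a := b)]
    exact measure_mono hb
  rw [eq_neg_of_add_eq_zero_left hz, hBn, inv_one, mul_one]

/-! ### The exponent on the half-line and existence of a root -/

/-- The exponent `γ` of the ground state on the half-line, the smaller solution of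
`γ (1 - γ) = lam`. -/
noncomputable def rayExponent (lam : ℝ) : ℝ := (1 - √(1 - 4 * lam)) / 2

theorem rayExponent_mul {lam : ℝ} (h : lam ≤ 1 / 4) :
    rayExponent lam * (1 - rayExponent lam) = lam := by
  have := Real.sq_sqrt (show 0 ≤ 1 - 4 * lam by linarith)
  rw [rayExponent]
  linear_combination (-1 / 4 : ℝ) * this

/-- Strictness matters: it makes the power `1 - 2γ` in the error of the trial functions positive. -/
theorem rayExponent_lt {lam : ℝ} (h : lam < 1 / 4) : rayExponent lam < 1 / 2 := by
  have := Real.sqrt_pos.2 (show 0 < 1 - 4 * lam by linarith)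
  rw [rayExponent]
  linarith

theorem rayExponent_pos {lam : ℝ} (h : 0 < lam) : 0 < rayExponent lam := by
  have : √(1 - 4 * lam) < 1 := by
    rw [Real.sqrt_lt' one_pos]
    linarith
  rw [rayExponent]
  linarith

/-- Intermediate value theorem in `k = √λ` on `(0, β)`, between the value `1` at `k = 0` and a value
below `cos(2πβ)` at `k = β`. For `β = 1/2` the second comparison degenerates, and a factor has to be
split off first. -/
theorem exists_isLambdaRoot {β : ℝ} (h0 : 0 < β) (h1 : β ≤ 1 / 2) : ∃ lam, IsLambdaRoot β lam := by
  have hπ := Real.pi_pos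
  -- The coefficient `(1 - √(1 - 4k²)) / (4k)` with its numerator rationalised, which makes it
  -- continuous at `k = 0`.
  let m : ℝ → ℝ := fun k => k / (1 + √(1 - 4 * k ^ 2))
  have hm : Continuous m := by
    refine continuous_id.div (by fun_prop) fun k => ?_
    have := Real.sqrt_nonneg (1 - 4 * k ^ 2)
    positivity
  suffices h : ∃ k ∈ Ioo 0 β, Real.cos (2 * Real.pi * β) =
      Real.cos (2 * Real.pi * k) - m k * Real.sin (2 * Real.pi * k) by
    obtain ⟨k, hk, hroot⟩ := h
    refine ⟨k ^ 2, ⟨by have := hk.1; positivity, by have := hk.1; have := hk.2; gcongr⟩, ?_⟩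
    rw [Real.sqrt_sq hk.1.le, hroot]
    have hs := Real.sq_sqrt (show 0 ≤ 1 - 4 * k ^ 2 by nlinarith [hk.1, hk.2])
    have hs0 := Real.sqrt_nonneg (1 - 4 * k ^ 2)
    have hmk : m k = (1 - √(1 - 4 * k ^ 2)) / (4 * k) := by
      have hk0 := hk.1
      simp only [m]
      rw [div_eq_div_iff (by positivity) (by positivity)]
      linear_combination hs
    rw [hmk]
  rcases h1.lt_or_eq with h1 | rfl
  · let F : ℝ → ℝ := fun k => Real.cos (2 * Real.pi * k) - m k * Real.sin (2 * Real.pi * k)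
    have hF : ContinuousOn F (Icc 0 β) := by fun_prop
    have hsin : 0 < Real.sin (2 * Real.pi * β) :=
      Real.sin_pos_of_pos_of_lt_pi (by positivity) (by nlinarith)
    have hmβ : 0 < m β := by
      have := Real.sqrt_nonneg (1 - 4 * β ^ 2)
      positivity
    have hc : Real.cos (2 * Real.pi * β) < 1 := by
      have := Real.cos_lt_cos_of_nonneg_of_le_pi le_rfl (show 2 * Real.pi * β ≤ Real.pi by nlinarith)
        (show 0 < 2 * Real.pi * β by positivity)
      rwa [Real.cos_zero] at this
    obtain ⟨k, hk, hroot⟩ := intermediate_value_Ioo' h0.le hF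
      (show Real.cos (2 * Real.pi * β) ∈ Ioo (F β) (F 0) from
        ⟨by simp only [F]; nlinarith [mul_pos hmβ hsin], by simpa [F] using hc⟩)
    exact ⟨k, hk, hroot.symm⟩
  -- At `β = 1/2` the sine vanishes at the endpoint, and `k = 1/2` solves the equation itself. By
  -- the double angle formulas the equation is `cos(πk) (cos(πk) - m sin(πk)) = 0`; the second
  -- factor changes sign inside the interval.
  · let F : ℝ → ℝ := fun k => Real.cos (Real.pi * k) - m k * Real.sin (Real.pi * k)
    have hF : ContinuousOn F (Icc 0 (1 / 2)) := by fun_prop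
    have e1 : Real.pi * (1 / 2) = Real.pi / 2 := by ring
    have hmβ : 0 < m (1 / 2) := by
      have := Real.sqrt_nonneg (1 - 4 * (1 / 2 : ℝ) ^ 2)
      positivity
    obtain ⟨k, hk, hroot⟩ := intermediate_value_Ioo' h0.le hF
      (show (0 : ℝ) ∈ Ioo (F (1 / 2)) (F 0) from
        ⟨by simp only [F]; rw [e1, Real.cos_pi_div_two, Real.sin_pi_div_two]; linarith,
          by simp [F]⟩)
    refine ⟨k, hk, ?_⟩
    have e2 : 2 * Real.pi * (1 / 2) = Real.pi := by ring
    have e3 : 2 * Real.pi * k = 2 * (Real.pi * k) := by ring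
    rw [e2, e3, Real.cos_pi, Real.cos_two_mul, Real.sin_two_mul]
    simp only [F] at hroot
    linear_combination (-2 * Real.cos (Real.pi * k)) * hroot

/-! ### Distance to the integers and the gauge transformation -/

theorem distInt_pos {α : ℝ} (hα : ¬∃ n : ℤ, α = (n : ℝ)) : 0 < distInt α :=
  abs_pos.2 fun h => hα ⟨round α, sub_eq_zero.1 h⟩

theorem distInt_le_half (α : ℝ) : distInt α ≤ 1 / 2 := abs_sub_round α

/-- The cosine is even and periodic, so the equation for `β` is one for the real part of the gauge
phase `exp(-2πiα)`. -/
theorem cos_two_pi_distInt (α : ℝ) :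
    Real.cos (2 * Real.pi * distInt α) = Real.cos (2 * Real.pi * α) := by
  have : 2 * Real.pi * distInt α = |2 * Real.pi * α - round α * (2 * Real.pi)| := by
    rw [distInt, ← abs_of_pos Real.two_pi_pos, ← abs_mul, abs_of_pos Real.two_pi_pos]
    ring_nf
  rw [this, Real.cos_abs, Real.cos_sub_int_mul_two_pi]

/-- The gauge transformation `exp (i ∫₀^θ a)`. -/
noncomputable def gauge (a : ℝ → ℝ) (θ : ℝ) : ℂ :=
  Complex.exp ((∫ t in 0..θ, a t : ℝ) * Complex.I)

@[simp] theorem norm_gauge (a : ℝ → ℝ) (θ : ℝ) : ‖gauge a θ‖ = 1 :=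
  Complex.norm_exp_ofReal_mul_I _

@[simp] theorem gauge_zero (a : ℝ → ℝ) : gauge a 0 = 1 := by simp [gauge]

theorem gauge_neg_mul_gauge (a : ℝ → ℝ) (θ : ℝ) : gauge (-a) θ * gauge a θ = 1 := by
  simp [gauge, ← Complex.exp_add]

theorem gauge_two_pi (a : ℝ → ℝ) :
    gauge a (2 * Real.pi) = Complex.exp ((2 * Real.pi * flux a : ℝ) * Complex.I) := by
  rw [gauge, flux, intervalIntegral.integral_of_le Real.two_pi_pos.le, integral_Ioc_eq_integral_Ioo]
  congr 3
  rw [circleEdge]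
  field_simp

/-- Transfers absolute continuity from `∫ a` to the gauge factor, which need not be differentiable
everywhere. -/
theorem lipschitzWith_exp_ofReal_mul_I :
    LipschitzWith 1 fun t : ℝ => Complex.exp (t * Complex.I) := by
  have hd : ∀ t : ℝ, HasDerivAt (fun t : ℝ => Complex.exp (t * Complex.I))
      (Complex.exp (t * Complex.I) * (1 * Complex.I)) t := fun t =>
    ((Complex.ofRealCLM.hasDerivAt (x := t)).mul_const Complex.I).cexp
  refine lipschitzWith_of_nnnorm_deriv_le (fun t => (hd t).differentiableAt) fun t => ?_
  rw [(hd t).deriv, ← NNReal.coe_le_coe]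
  simp

theorem absolutelyContinuousOnInterval_gauge {a : ℝ → ℝ}
    (ha : IntervalIntegrable a volume 0 (2 * Real.pi)) :
    AbsolutelyContinuousOnInterval (gauge a) 0 (2 * Real.pi) :=
  lipschitzWith_exp_ofReal_mul_I.comp_absolutelyContinuousOnInterval
    (ha.absolutelyContinuousOnInterval_intervalIntegral left_mem_uIcc)

theorem ae_hasDerivAt_gauge {a : ℝ → ℝ} (ha : IntervalIntegrable a volume 0 (2 * Real.pi)) :
    ∀ᵐ θ, θ ∈ uIcc 0 (2 * Real.pi) → HasDerivAt (gauge a) (a θ * Complex.I * gauge a θ) θ := by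
  filter_upwards [ha.ae_hasDerivAt_integral] with θ h hθ
  have := ((h hθ 0 left_mem_uIcc).ofReal_comp.mul_const Complex.I).cexp
  refine this.congr_deriv ?_
  rw [gauge]; ring

/-! ### Sobolev functions on the edges and their values at the vertex -/

theorem intervalIntegrable_of_memLp {E : Type*} [NormedAddCommGroup E] {f : ℝ → E}
    (hf : MemLp f 2 (volume.restrict circleEdge)) :
    IntervalIntegrable f volume 0 (2 * Real.pi) := by
  rw [intervalIntegrable_iff_integrableOn_Ioo_of_le Real.two_pi_pos.le]
  have : IsFiniteMeasure (volume.restrict circleEdge) := ⟨by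
    rw [Measure.restrict_apply_univ, circleEdge, Real.volume_Ioo]; exact ENNReal.ofReal_lt_top⟩
  exact hf.integrable (by norm_num)

theorem setIntegral_circleEdge (f : ℝ → ℝ) :
    ∫ θ in circleEdge, f θ = ∫ θ in 0..2 * Real.pi, f θ := by
  rw [intervalIntegral.integral_of_le Real.two_pi_pos.le, integral_Ioc_eq_integral_Ioo, circleEdge]

theorem _root_.MemH1On.hasWeakDerivOn {I : Set ℝ} {f : ℝ → ℂ} (h : MemH1On I f) :
    HasWeakDerivOn I f (weakDerivOn I f) := by
  obtain ⟨-, g, hg, -⟩ := h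
  have he : ∃ g, HasWeakDerivOn I f g := ⟨g, hg⟩
  rw [weakDerivOn, dif_pos he]
  exact he.choose_spec

theorem _root_.MemH1On.memLp_weakDerivOn {I : Set ℝ} (hI : IsOpen I) {f : ℝ → ℂ} (h : MemH1On I f) :
    MemLp (weakDerivOn I f) 2 (volume.restrict I) := by
  obtain ⟨-, g, hg, hgL⟩ := h
  exact hgL.ae_eq (hg.weakDerivOn_ae_eq hI).symm

theorem MemH1.circle {u : graph → ℂ} (hu : MemH1 u) : MemH1On circleEdge (onCircle u) := hu.2.1

theorem MemH1.ray {u : graph → ℂ} (hu : MemH1 u) : MemH1On rayEdge (onRay u) := hu.2.2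

section Trace

variable {u : graph → ℂ}

theorem continuous_onCircle (hu : Continuous u) : Continuous (onCircle u) :=
  hu.comp (Continuous.subtype_mk (by fun_prop) _)

theorem continuousOn_onRay (hu : Continuous u) : ContinuousOn (onRay u) (Ici 1) := by
  rw [continuousOn_iff_continuous_domRestrict]
  have h : Continuous fun r : Ici (1 : ℝ) => u ⟨((r : ℝ) : ℂ), ofReal_mem_graph (mem_Ici.1 r.2)⟩ :=
    hu.comp (Continuous.subtype_mk (by fun_prop) _)
  refine h.congr fun r => ?_
  change _ = onRay u r
  rw [onRay, dif_pos (mem_Ici.1 r.2)]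

theorem onCircle_zero : onCircle u 0 = onRay u 1 := by
  simp [onCircle, onRay]

theorem onCircle_two_pi : onCircle u (2 * Real.pi) = onRay u 1 := by
  simp [onCircle, onRay]

theorem onCircle_weight_mul (θ : ℝ) :
    onCircle (fun x => weight x * ‖u x‖ ^ 2) θ = ‖onCircle u θ‖ ^ 2 := by
  simp [onCircle, weight, Complex.norm_exp_ofReal_mul_I]

theorem onRay_weight_mul {r : ℝ} (hr : 1 < r) :
    onRay (fun x => weight x * ‖u x‖ ^ 2) r = (r ^ 2)⁻¹ * ‖onRay u r‖ ^ 2 := by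
  have h : ¬‖(r : ℂ)‖ = 1 := by
    rw [Complex.norm_real, Real.norm_eq_abs, abs_of_pos (by linarith)]
    exact hr.ne'
  simp only [onRay, dif_pos hr.le, weight, if_neg h, Complex.ofReal_re]

end Trace

/-! ### The energy as a sum of squares and the Hardy inequality -/

section Energy

variable {a : ℝ → ℝ} {u : graph → ℂ}

theorem memLp_mul_onCircle (ha : MemLp a 2 (volume.restrict circleEdge)) (hu : Continuous u) :
    MemLp (fun θ => (a θ : ℂ) * onCircle u θ) 2 (volume.restrict circleEdge) := by
  obtain ⟨K, hK⟩ := (isCompact_Icc (a := (0 : ℝ)) (b := 2 * Real.pi)).exists_bound_of_continuousOn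
    (continuous_onCircle hu).continuousOn
  refine ha.of_le_mul (c := K) ?_ ?_
  · exact (Complex.continuous_ofReal.comp_aestronglyMeasurable ha.1).mul
      (continuous_onCircle hu).aestronglyMeasurable
  · refine (ae_restrict_iff' measurableSet_Ioo).2 (Eventually.of_forall fun θ hθ => ?_)
    rw [norm_mul, Complex.norm_real, mul_comm]
    exact mul_le_mul_of_nonneg_right (hK θ (Ioo_subset_Icc_self hθ)) (norm_nonneg _)

theorem integrableOn_magneticDensity (ha : MemLp a 2 (volume.restrict circleEdge))
    (hu : MemH1 u) : IntegrableOn (magneticDensity a u) circleEdge :=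
  integrable_norm_sq (((hu.circle.memLp_weakDerivOn isOpen_Ioo).const_mul (-Complex.I)).sub
    (memLp_mul_onCircle ha hu.1))

theorem integrableOn_rayDensity (hu : MemH1 u) : IntegrableOn (rayDensity u) rayEdge :=
  integrable_norm_sq (hu.ray.memLp_weakDerivOn isOpen_Ioi)

theorem graphIntegrable_weight_mul (hu : MemH1 u) :
    GraphIntegrable (fun x => weight x * ‖u x‖ ^ 2) :=
  ⟨(integrable_norm_sq hu.circle.1).congr (Eventually.of_forall fun θ => (onCircle_weight_mul θ).symm),
    (integrableOn_inv_sq_mul hu.ray.1).congr_fun (fun _ hr => (onRay_weight_mul hr).symm)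
      measurableSet_Ioi⟩

/-- The gauge transform of a function on the circle. -/
noncomputable def gaugedCircle (a : ℝ → ℝ) (u : graph → ℂ) (θ : ℝ) : ℂ :=
  gauge (-a) θ * onCircle u θ

/-- The derivative of the gauge transform of a function on the circle. -/
noncomputable def gaugedDeriv (a : ℝ → ℝ) (u : graph → ℂ) (θ : ℝ) : ℂ :=
  gauge (-a) θ * (weakDerivOn circleEdge (onCircle u) θ - Complex.I * a θ * onCircle u θ)

theorem norm_gaugedCircle (θ : ℝ) : ‖gaugedCircle a u θ‖ = ‖onCircle u θ‖ := by
  simp [gaugedCircle]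

/-- Since `-iu' - au = -i(u' - iau)`, the two sides differ by factors of modulus one: the gauge
turns the magnetic energy into a free one. -/
theorem norm_gaugedDeriv_sq (θ : ℝ) : ‖gaugedDeriv a u θ‖ ^ 2 = magneticDensity a u θ := by
  have : -Complex.I * weakDerivOn circleEdge (onCircle u) θ - (a θ : ℂ) * onCircle u θ =
      -Complex.I * (weakDerivOn circleEdge (onCircle u) θ - Complex.I * a θ * onCircle u θ) := by
    linear_combination (-(a θ : ℂ) * onCircle u θ) * Complex.I_mul_I
  rw [magneticDensity, this, gaugedDeriv]
  simp

theorem onCircle_eq_add_integral (hu : MemH1 u) : ∀ θ ∈ uIcc 0 (2 * Real.pi),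
    onCircle u θ = onCircle u 0 + ∫ t in 0..θ, weakDerivOn circleEdge (onCircle u) t :=
  hu.circle.hasWeakDerivOn.eq_add_integral_Icc Real.two_pi_pos (continuous_onCircle hu.1).continuousOn
    (intervalIntegrable_of_memLp (hu.circle.memLp_weakDerivOn isOpen_Ioo))

theorem absolutelyContinuousOnInterval_gaugedCircle (ha : MemLp a 2 (volume.restrict circleEdge))
    (hu : MemH1 u) : AbsolutelyContinuousOnInterval (gaugedCircle a u) 0 (2 * Real.pi) :=
  (absolutelyContinuousOnInterval_gauge (intervalIntegrable_of_memLp ha.neg)).fun_smul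
    (absolutelyContinuousOnInterval_of_eq_add_integral
      (intervalIntegrable_of_memLp (hu.circle.memLp_weakDerivOn isOpen_Ioo))
      (onCircle_eq_add_integral hu))

theorem ae_hasDerivAt_gaugedCircle (ha : MemLp a 2 (volume.restrict circleEdge))
    (hu : MemH1 u) : ∀ᵐ θ, θ ∈ uIcc 0 (2 * Real.pi) →
      HasDerivAt (gaugedCircle a u) (gaugedDeriv a u θ) θ := by
  filter_upwards [ae_hasDerivAt_gauge (intervalIntegrable_of_memLp ha.neg),
    ae_hasDerivAt_of_eq_add_integral
      (intervalIntegrable_of_memLp (hu.circle.memLp_weakDerivOn isOpen_Ioo)) Real.two_pi_pos.le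
      (onCircle_eq_add_integral hu)] with θ h1 h2 hθ
  refine ((h1 hθ).mul (h2 hθ)).congr_deriv ?_
  simp only [gaugedDeriv, circleEdge, Pi.neg_apply, Complex.ofReal_neg]
  ring

/-- The Robin constant `c` of the ground state on the circle. -/
noncomputable def circleConst (a : ℝ → ℝ) (k : ℝ) : ℂ :=
  ((k / (2 * Real.sin (k * Real.pi)) : ℝ) : ℂ) * (gauge (-a) (2 * Real.pi) - 1)

theorem re_gauge_two_pi (a : ℝ → ℝ) :
    (gauge (-a) (2 * Real.pi)).re = Real.cos (2 * Real.pi * distInt (flux a)) := by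
  have : flux (-a) = -flux a := by simp [flux, integral_neg]
  rw [gauge_two_pi, Complex.exp_ofReal_mul_I_re, this, cos_two_pi_distInt, mul_neg, Real.cos_neg]

theorem integrableOn_circleRemainder (ha : MemLp a 2 (volume.restrict circleEdge)) (hu : MemH1 u) {k : ℝ}
    (hk : 0 < k) (hk2 : k < 1 / 2) (c : ℂ) :
    IntegrableOn (fun θ => ‖circleRemainder k c (gaugedCircle a u) (gaugedDeriv a u) θ‖ ^ 2)
      circleEdge := by
  have hac := absolutelyContinuousOnInterval_gaugedCircle ha hu
  have hd := ae_hasDerivAt_gaugedCircle ha hu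
  -- The difference of the densities is the a.e. derivative of an absolutely continuous function,
  -- hence integrable; the remainder is then a combination of integrable functions.
  have h1 := (absolutelyContinuousOnInterval_circleBoundary hk hk2 c
    hac).intervalIntegrable_of_ae_hasDerivAt (hd.mono fun x hx hm =>
      hasDerivAt_circleBoundary hk.ne' (cos_mul_sub_pi_pos hk hk2
        (by rwa [uIcc_of_le Real.two_pi_pos.le] at hm)).ne' c (hx hm))
  rw [intervalIntegrable_iff_integrableOn_Ioo_of_le Real.two_pi_pos.le] at h1
  have h2 := (integrableOn_magneticDensity ha hu).sub
    ((integrable_norm_sq hu.circle.1).const_mul (k ^ 2))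
  refine (h2.sub h1).congr (Eventually.of_forall fun θ => ?_)
  simp only [Pi.sub_apply, norm_gaugedDeriv_sq, norm_gaugedCircle]
  ring

theorem integral_sub_const_mul_sub {μ : Measure ℝ} {f g h : ℝ → ℝ} (hf : Integrable f μ)
    (hg : Integrable g μ) (hh : Integrable h μ) (c : ℝ) :
    ∫ x, (f x - c * g x - h x) ∂μ = ∫ x, f x ∂μ - c * ∫ x, g x ∂μ - ∫ x, h x ∂μ := by
  have h1 : Integrable (fun x => f x - c * g x) μ := hf.sub (hg.const_mul c)
  rw [integral_sub h1 hh, integral_sub hf (hg.const_mul c), integral_const_mul]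

/-- The energy minus the weighted norm is a sum of two squares. -/
theorem magneticForm_sub_eq (ha : MemLp a 2 (volume.restrict circleEdge)) {lam : ℝ}
    (hlam : IsLambdaRoot (distInt (flux a)) lam) (hu : MemH1 u) :
    magneticForm a u - lam * graphIntegral (fun x => weight x * ‖u x‖ ^ 2) =
      (∫ θ in circleEdge, ‖circleRemainder (√lam) (circleConst a √lam * onRay u 1)
        (gaugedCircle a u) (gaugedDeriv a u) θ‖ ^ 2) +
      ∫ r in rayEdge, ‖rayRemainder (rayExponent lam) (onRay u)
        (weakDerivOn rayEdge (onRay u)) r‖ ^ 2 := by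
  obtain ⟨⟨h0, h1⟩, hroot⟩ := hlam
  have hβ : distInt (flux a) ^ 2 ≤ 1 / 4 := by
    have := distInt_le_half (flux a)
    have h' : 0 ≤ distInt (flux a) := abs_nonneg _
    nlinarith
  have hk : 0 < √lam := Real.sqrt_pos.2 h0
  have hk2 : √lam < 1 / 2 := by
    rw [Real.sqrt_lt' (by norm_num)]
    linarith
  have hksq : √lam ^ 2 = lam := Real.sq_sqrt h0.le
  have hγ := rayExponent_mul (lam := lam) (by linarith)
  set c := circleConst a √lam * onRay u 1 with hc
  have hcirc := integral_circle_eq hk hk2 c (absolutelyContinuousOnInterval_gaugedCircle ha hu)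
    (ae_hasDerivAt_gaugedCircle ha hu)
  -- With `γ = (1 - √(1 - 4λ)) / 2`, the coefficient of the sine in the equation is `γ / (2√λ)`. The
  -- circle thus contributes `γ|u(1)|²`, which the half-line cancels.
  rw [circleBoundary_sub (γ := rayExponent lam) hk hk2 (norm_gauge (-a) (2 * Real.pi))
    (re_gauge_two_pi a) (by rw [hroot, rayExponent]; congr 2; field_simp; ring)
    (p := onRay u 1) (by rw [hc, circleConst]; ring)
    (by rw [gaugedCircle, gauge_zero, one_mul, onCircle_zero])
    (by rw [gaugedCircle, onCircle_two_pi]), ← setIntegral_circleEdge] at hcirc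
  simp only [norm_gaugedDeriv_sq, norm_gaugedCircle, hksq] at hcirc
  have hray := integral_ray_eq (continuousOn_onRay hu.1) hu.ray.1
    (hu.ray.memLp_weakDerivOn isOpen_Ioi) hu.ray.hasWeakDerivOn (rayExponent lam)
  rw [hγ] at hray
  have hi1 := integrableOn_magneticDensity ha hu
  have hi2 := integrable_norm_sq hu.circle.1
  have hi3 := integrableOn_circleRemainder ha hu hk hk2 c
  have hj2 := integrableOn_inv_sq_mul hu.ray.1
  have hj3 := integrable_norm_sq (memLp_rayRemainder hu.ray.1
    (hu.ray.memLp_weakDerivOn isOpen_Ioi) (rayExponent lam))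
  rw [integral_sub_const_mul_sub hi1 hi2 hi3] at hcirc
  rw [integral_sub_const_mul_sub (integrable_norm_sq (hu.ray.memLp_weakDerivOn isOpen_Ioi)) hj2
    hj3] at hray
  have hg1 : ∫ θ in circleEdge, onCircle (fun x => weight x * ‖u x‖ ^ 2) θ =
      ∫ θ in circleEdge, ‖onCircle u θ‖ ^ 2 := by simp only [onCircle_weight_mul]
  have hg2 : ∫ r in rayEdge, onRay (fun x => weight x * ‖u x‖ ^ 2) r =
      ∫ r in Ioi 1, (r ^ 2)⁻¹ * ‖onRay u r‖ ^ 2 :=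
    setIntegral_congr_fun measurableSet_Ioi fun r hr => onRay_weight_mul hr
  rw [magneticForm, graphIntegral, hg1, hg2]
  simp only [rayEdge, rayDensity] at hray ⊢
  linear_combination hcirc + hray

theorem hardyInequality_of_isLambdaRoot (ha : MemLp a 2 (volume.restrict circleEdge)) {lam : ℝ}
    (hlam : IsLambdaRoot (distInt (flux a)) lam) : HardyInequality a lam := fun u hu => by
  rw [← sub_nonneg, magneticForm_sub_eq ha hlam hu]
  exact add_nonneg (integral_nonneg fun _ => sq_nonneg _) (integral_nonneg fun _ => sq_nonneg _)

end Energy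

/-! ### Trial functions -/

/-- A continuous function on the graph with prescribed restrictions to the two edges. -/
theorem exists_continuous_onCircle_onRay {w ρ : ℝ → ℂ} (hw : ContinuousOn w (Icc 0 (2 * Real.pi)))
    (hw0 : w 0 = 1) (hw1 : w (2 * Real.pi) = 1) (hρ : ContinuousOn ρ (Ici 1)) (hρ1 : ρ 1 = 1) :
    ∃ u : graph → ℂ, Continuous u ∧ (∀ θ ∈ Ico 0 (2 * Real.pi), onCircle u θ = w θ) ∧
      ∀ r, 1 ≤ r → onRay u r = ρ r := by
  have hfact : Fact (0 < 2 * Real.pi) := ⟨Real.two_pi_pos⟩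
  have hne : ∀ z : graph, 1 ≤ ‖(z : ℂ)‖ := by
    rintro ⟨z, hz | ⟨r, hr, rfl⟩⟩
    · exact (show ‖z‖ = 1 from hz).ge
    · rw [Complex.norm_real, Real.norm_eq_abs]
      exact hr.le.trans (le_abs_self r)
  let W : Circle → ℂ := fun z => AddCircle.liftIco (2 * Real.pi) 0 w
    (AddCircle.homeomorphCircle'.symm z)
  have hW : Continuous W :=
    (AddCircle.liftIco_zero_continuous (hw0.trans hw1.symm) hw).comp (Homeomorph.continuous _)
  have hWexp : ∀ θ ∈ Ico 0 (2 * Real.pi), W (Circle.exp θ) = w θ := fun θ hθ => by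
    simp only [W]
    rw [← AddCircle.homeomorphCircle'_apply_mk, Homeomorph.symm_apply_apply]
    exact AddCircle.liftIco_zero_coe_apply hθ
  let P : graph → Circle := fun z => ⟨(z : ℂ) / ‖(z : ℂ)‖, by
    have := hne z
    refine mem_sphere_zero_iff_norm.2 ?_
    rw [norm_div, Complex.norm_real, norm_norm, div_self (by linarith)]⟩
  have hP : Continuous P := by
    refine Continuous.subtype_mk (continuous_subtype_val.div
      (Complex.continuous_ofReal.comp continuous_subtype_val.norm) fun z => ?_) _
    have := hne z
    exact Complex.ofReal_ne_zero.2 (by linarith)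
  have hPexp : ∀ θ : ℝ, P ⟨Complex.exp (θ * Complex.I), exp_mem_graph θ⟩ = Circle.exp θ := fun θ =>
    Circle.ext (by simp [P, Circle.coe_exp])
  have hPray : ∀ (r : ℝ) (hr : 1 ≤ r), P ⟨(r : ℂ), ofReal_mem_graph hr⟩ = Circle.exp 0 :=
    fun r hr => Circle.ext (by
      have : (r : ℂ) ≠ 0 := Complex.ofReal_ne_zero.2 (by linarith)
      simp [P, abs_of_pos (show 0 < r by linarith), div_self this])
  -- One formula serves both edges: the modulus is `1` on the circle, the direction `z/|z|` is `1`
  -- on the ray, and both factors equal `1` there. Continuity at the vertex is then automatic.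
  refine ⟨fun z => W (P z) * ρ ‖(z : ℂ)‖, ?_, fun θ hθ => ?_, fun r hr => ?_⟩
  · exact (hW.comp hP).mul (hρ.comp_continuous continuous_subtype_val.norm hne)
  · simp only [onCircle]
    rw [hPexp, hWexp θ hθ, Complex.norm_exp_ofReal_mul_I, hρ1, mul_one]
  · simp only [onRay, dif_pos hr]
    rw [hPray r hr, hWexp 0 (by simp [Real.pi_pos]), hw0, one_mul, Complex.norm_real,
      Real.norm_eq_abs, abs_of_pos (by linarith)]

/-- The ground state on the circle in the gauge without magnetic potential. -/
noncomputable def groundCircle (k : ℝ) (c : ℂ) (θ : ℝ) : ℂ :=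
  ((Real.cos (k * (θ - Real.pi)) / Real.cos (k * Real.pi) : ℝ) : ℂ) + c *
    (((Real.sin (k * (θ - Real.pi)) + Real.tan (k * Real.pi) * Real.cos (k * (θ - Real.pi))) / k : ℝ)
      : ℂ)

/-- The derivative of `groundCircle`. -/
noncomputable def groundCircleDeriv (k : ℝ) (c : ℂ) (θ : ℝ) : ℂ :=
  ((-k * Real.sin (k * (θ - Real.pi)) / Real.cos (k * Real.pi) : ℝ) : ℂ) + c *
    ((Real.cos (k * (θ - Real.pi)) - Real.tan (k * Real.pi) * Real.sin (k * (θ - Real.pi)) : ℝ) : ℂ)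

theorem hasDerivAt_groundCircle {k : ℝ} (hk : k ≠ 0) (c : ℂ) (θ : ℝ) :
    HasDerivAt (groundCircle k c) (groundCircleDeriv k c θ) θ := by
  have h1 : HasDerivAt (fun θ : ℝ => k * (θ - Real.pi)) (k * 1) θ :=
    ((hasDerivAt_id θ).sub_const _).const_mul k
  have hs := h1.sin
  have hc := h1.cos
  refine ((hc.div_const (Real.cos (k * Real.pi))).ofReal_comp.add
    ((((hs.add (hc.const_mul (Real.tan (k * Real.pi)))).div_const k).ofReal_comp).const_mul
      c)).congr_deriv ?_
  rw [groundCircleDeriv]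
  congr 2
  · congr 1; ring
  · congr 1; field_simp; ring

theorem continuous_groundCircleDeriv (k : ℝ) (c : ℂ) : Continuous (groundCircleDeriv k c) := by
  unfold groundCircleDeriv
  fun_prop

theorem groundCircle_zero {k : ℝ} (h : Real.cos (k * Real.pi) ≠ 0) (c : ℂ) :
    groundCircle k c 0 = 1 := by
  have e0 : k * (0 - Real.pi) = -(k * Real.pi) := by ring
  rw [groundCircle, e0, Real.sin_neg, Real.cos_neg, div_self h, Real.tan_mul_cos h]
  simp

/-- The term multiplying `c` takes the value `2 sin(kπ)/k` at `2π`. The choice of `circleConst` thus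
matches the gauge phase, and the regauged function closes up at the vertex. -/
theorem groundCircle_two_pi {k : ℝ} (hk : k ≠ 0) (h : Real.cos (k * Real.pi) ≠ 0)
    (hs : Real.sin (k * Real.pi) ≠ 0) (a : ℝ → ℝ) :
    groundCircle k (circleConst a k) (2 * Real.pi) = gauge (-a) (2 * Real.pi) := by
  have e1 : k * (2 * Real.pi - Real.pi) = k * Real.pi := by ring
  rw [groundCircle, e1, div_self h, Real.tan_mul_cos h, circleConst, mul_right_comm,
    ← Complex.ofReal_mul]
  have : k / (2 * Real.sin (k * Real.pi)) *
      ((Real.sin (k * Real.pi) + Real.sin (k * Real.pi)) / k) = 1 := by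
    field_simp; norm_num
  rw [this]
  simp

/-- Multiplied by `cos(k(θ-π))`, the remainder is the Wronskian with that cosine minus `c`. The
first term of the ground state has Wronskian zero, the factor multiplying `c` has Wronskian one. -/
theorem circleRemainder_groundCircle {k θ : ℝ} (hk : k ≠ 0)
    (h : Real.cos (k * (θ - Real.pi)) ≠ 0) (h0 : Real.cos (k * Real.pi) ≠ 0) (c : ℂ) :
    circleRemainder k c (groundCircle k c) (groundCircleDeriv k c) θ = 0 := by
  have hsc := Real.sin_sq_add_cos_sq (k * (θ - Real.pi))
  rw [circleRemainder, groundCircle, groundCircleDeriv, circleTan, circleSec,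
    Real.tan_eq_sin_div_cos (k * (θ - Real.pi))]
  set S := Real.sin (k * (θ - Real.pi))
  set D := Real.cos (k * (θ - Real.pi))
  set T := Real.tan (k * Real.pi)
  set D0 := Real.cos (k * Real.pi)
  have e1 : -k * S / D0 + k * (S / D) * (D / D0) = 0 := by field_simp; ring
  have e2 : (D - T * S) + k * (S / D) * ((S + T * D) / k) - D⁻¹ = 0 := by
    field_simp; linear_combination hsc
  have e1' := congrArg Complex.ofReal e1
  have e2' := congrArg Complex.ofReal e2
  push_cast at e1' e2' ⊢
  linear_combination e1' + c * e2'

/-- The truncated ground state on the half-line. -/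
noncomputable def groundRay (γ ε r : ℝ) : ℝ := r ^ γ * Real.exp (-(ε * (r - 1)))

/-- The exponential cutoff changes the logarithmic derivative by exactly `-ε`, so the remainder on
the ray is `-ε` times the function itself. -/
theorem hasDerivAt_groundRay (γ ε : ℝ) {r : ℝ} (hr : 0 < r) :
    HasDerivAt (groundRay γ ε) ((γ * r⁻¹ - ε) * groundRay γ ε r) r := by
  have h1 := Real.hasDerivAt_rpow_const (p := γ) (Or.inl hr.ne')
  have h2 : HasDerivAt (fun r : ℝ => -(ε * (r - 1))) (-(ε * 1)) r :=
    (((hasDerivAt_id r).sub_const 1).const_mul ε).neg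
  refine (h1.mul h2.exp).congr_deriv ?_
  rw [groundRay, Real.rpow_sub_one hr.ne']
  ring

theorem continuousOn_groundRay (γ ε : ℝ) : ContinuousOn (groundRay γ ε) (Ioi 0) := fun _ hr =>
  (hasDerivAt_groundRay γ ε hr).continuousAt.continuousWithinAt

theorem groundRay_sq (γ ε : ℝ) {r : ℝ} (hr : 0 < r) :
    groundRay γ ε r ^ 2 =
      Real.exp (2 * ε) * (r ^ (2 * γ + 1 - 1) * Real.exp (-(2 * ε * r))) := by
  have h1 : r ^ (2 * γ + 1 - 1) = (r ^ γ) ^ 2 := by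
    rw [add_sub_cancel_right, mul_comm, Real.rpow_mul hr.le, Real.rpow_two]
  have h2 : Real.exp (-(ε * (r - 1))) ^ 2 = Real.exp (2 * ε) * Real.exp (-(2 * ε * r)) := by
    rw [← Real.exp_nat_mul, ← Real.exp_add]
    congr 1
    push_cast
    ring
  rw [groundRay, mul_pow, h1, h2]
  ring

theorem integrableOn_groundRay_sq {γ ε : ℝ} (hγ : 0 < γ) (hε : 0 < ε) :
    IntegrableOn (fun r => groundRay γ ε r ^ 2) (Ioi 0) := by
  have := (integrableOn_rpow_mul_exp_neg_mul_rpow (s := 2 * γ + 1 - 1) (p := 1) (b := 2 * ε)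
    (by linarith) one_pos (by positivity)).const_mul (Real.exp (2 * ε))
  refine IntegrableOn.congr_fun this (fun r hr => ?_) measurableSet_Ioi
  simp only [groundRay_sq γ ε hr, Real.rpow_one, neg_mul]

/-- Enlarging the domain to `(0, ∞)` makes the integral a Gamma integral, with growth `ε^(-2γ-1)` as
`ε → 0`. -/
theorem integral_groundRay_sq_le {γ ε : ℝ} (hγ : 0 < γ) (hε : 0 < ε) :
    ∫ r in Ioi 1, groundRay γ ε r ^ 2 ≤
      Real.exp (2 * ε) * ((1 / (2 * ε)) ^ (2 * γ + 1) * Real.Gamma (2 * γ + 1)) := by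
  rw [← Real.integral_rpow_mul_exp_neg_mul_Ioi (by linarith) (by positivity), ← integral_const_mul,
    ← setIntegral_congr_fun measurableSet_Ioi fun r hr => groundRay_sq γ ε hr]
  exact setIntegral_mono_set (integrableOn_groundRay_sq hγ hε)
    (Eventually.of_forall fun r => sq_nonneg _) (Ioi_subset_Ioi zero_le_one).eventuallyLE

theorem memLp_ofReal_of_sq {f : ℝ → ℝ} {I : Set ℝ} (hm : AEStronglyMeasurable f (volume.restrict I))
    (hf : IntegrableOn (fun r => f r ^ 2) I) :
    MemLp (fun r => (f r : ℂ)) 2 (volume.restrict I) := by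
  refine (memLp_two_iff_integrable_sq_norm
    (Complex.continuous_ofReal.comp_aestronglyMeasurable hm)).2 ?_
  simpa [IntegrableOn] using hf

theorem IsLambdaRoot.bounds {α lam : ℝ} (h : IsLambdaRoot (distInt α) lam) :
    0 < √lam ∧ √lam < 1 / 2 ∧ lam < 1 / 4 := by
  obtain ⟨⟨h0, h1⟩, -⟩ := h
  have hβ : distInt α ^ 2 ≤ 1 / 4 := by
    have := distInt_le_half α
    have h' : 0 ≤ distInt α := abs_nonneg _
    nlinarith
  refine ⟨Real.sqrt_pos.2 h0, ?_, by linarith⟩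
  rw [Real.sqrt_lt' (by norm_num)]
  linarith

variable {a : ℝ → ℝ}

/-- The ground state on the circle. -/
noncomputable def trialCircle (a : ℝ → ℝ) (k θ : ℝ) : ℂ :=
  gauge a θ * groundCircle k (circleConst a k) θ

/-- The derivative of the ground state on the circle. -/
noncomputable def trialCircleDeriv (a : ℝ → ℝ) (k θ : ℝ) : ℂ :=
  gauge a θ * (groundCircleDeriv k (circleConst a k) θ +
    (a θ : ℂ) * (Complex.I * groundCircle k (circleConst a k) θ))

theorem absolutelyContinuousOnInterval_trialCircle (ha : MemLp a 2 (volume.restrict circleEdge))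
    {k : ℝ} (hk : k ≠ 0) :
    AbsolutelyContinuousOnInterval (trialCircle a k) 0 (2 * Real.pi) := by
  refine (absolutelyContinuousOnInterval_gauge (intervalIntegrable_of_memLp ha)).fun_smul
    (ContDiffOn.absolutelyContinuousOnInterval (ContDiff.contDiffOn ?_))
  rw [contDiff_one_iff_deriv]
  refine ⟨fun θ => (hasDerivAt_groundCircle hk _ θ).differentiableAt, ?_⟩
  rw [show deriv (groundCircle k (circleConst a k)) = groundCircleDeriv k (circleConst a k) from
    funext fun θ => (hasDerivAt_groundCircle hk _ θ).deriv]
  exact continuous_groundCircleDeriv _ _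

theorem ae_hasDerivAt_trialCircle (ha : MemLp a 2 (volume.restrict circleEdge)) {k : ℝ}
    (hk : k ≠ 0) : ∀ᵐ θ, θ ∈ uIcc 0 (2 * Real.pi) →
      HasDerivAt (trialCircle a k) (trialCircleDeriv a k θ) θ := by
  filter_upwards [ae_hasDerivAt_gauge (intervalIntegrable_of_memLp ha)] with θ h hθ
  refine ((h hθ).mul (hasDerivAt_groundCircle hk (circleConst a k) θ)).congr_deriv ?_
  rw [trialCircleDeriv]
  ring

theorem memLp_of_continuous {f : ℝ → ℂ} (hf : Continuous f) :
    MemLp f 2 (volume.restrict circleEdge) := by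
  have : IsFiniteMeasure (volume.restrict circleEdge) := ⟨by
    rw [Measure.restrict_apply_univ, circleEdge, Real.volume_Ioo]; exact ENNReal.ofReal_lt_top⟩
  obtain ⟨K, hK⟩ := (isCompact_Icc (a := (0 : ℝ)) (b := 2 * Real.pi)).exists_bound_of_continuousOn
    hf.continuousOn
  exact MemLp.of_bound hf.aestronglyMeasurable K ((ae_restrict_iff' measurableSet_Ioo).2
    (Eventually.of_forall fun θ hθ => hK θ (Ioo_subset_Icc_self hθ)))

theorem continuous_groundCircle {k : ℝ} (hk : k ≠ 0) (c : ℂ) : Continuous (groundCircle k c) :=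
  continuous_iff_continuousAt.2 fun θ => (hasDerivAt_groundCircle hk c θ).continuousAt

theorem memLp_trialCircleDeriv (ha : MemLp a 2 (volume.restrict circleEdge)) {k : ℝ}
    (hk : k ≠ 0) : MemLp (trialCircleDeriv a k) 2 (volume.restrict circleEdge) := by
  have h1 := memLp_of_continuous (continuous_groundCircleDeriv k (circleConst a k))
  have h2 : MemLp (fun θ => (a θ : ℂ) * (Complex.I * groundCircle k (circleConst a k) θ)) 2
      (volume.restrict circleEdge) := by
    have hc : Continuous fun θ => Complex.I * groundCircle k (circleConst a k) θ :=
      continuous_const.mul (continuous_groundCircle hk _)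
    obtain ⟨K, hK⟩ := (isCompact_Icc (a := (0 : ℝ))
      (b := 2 * Real.pi)).exists_bound_of_continuousOn hc.continuousOn
    refine ha.of_le_mul (c := K) ?_ ?_
    · exact (Complex.continuous_ofReal.comp_aestronglyMeasurable ha.1).mul hc.aestronglyMeasurable
    · refine (ae_restrict_iff' measurableSet_Ioo).2 (Eventually.of_forall fun θ hθ => ?_)
      rw [norm_mul, Complex.norm_real, mul_comm]
      exact mul_le_mul_of_nonneg_right (hK θ (Ioo_subset_Icc_self hθ)) (norm_nonneg _)
  have hg := (absolutelyContinuousOnInterval_gauge (intervalIntegrable_of_memLp ha)).continuousOn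
  rw [uIcc_of_le Real.two_pi_pos.le] at hg
  refine (h1.add h2).of_le ?_ (Eventually.of_forall fun θ => ?_)
  · exact ((hg.mono Ioo_subset_Icc_self).aestronglyMeasurable measurableSet_Ioo).mul
      (h1.add h2).1
  · simp [trialCircleDeriv]

/-- The ray part of a trial function lies in `H¹`. -/
theorem hasWeakDerivOn_groundRay {γ ε : ℝ} {f : ℝ → ℂ}
    (hf : ∀ r, 1 ≤ r → f r = groundRay γ ε r) :
    HasWeakDerivOn rayEdge f (fun r => ((γ * r⁻¹ - ε : ℝ) : ℂ) * groundRay γ ε r) := by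
  have hd : ∀ r ∈ Ioi (1 : ℝ), HasDerivAt f (((γ * r⁻¹ - ε : ℝ) : ℂ) * groundRay γ ε r) r := by
    intro r hr
    have hr1 : (1 : ℝ) < r := hr
    have := (hasDerivAt_groundRay γ ε (r := r) (by linarith)).ofReal_comp
    rw [Complex.ofReal_mul] at this
    refine this.congr_of_eventuallyEq ?_
    filter_upwards [Ioi_mem_nhds hr1] with s hs using hf s (le_of_lt hs)
  have hfc : ContinuousOn f (Ioi 1) := fun r hr => (hd r hr).continuousAt.continuousWithinAt
  have hgc : ContinuousOn (fun r => ((γ * r⁻¹ - ε : ℝ) : ℂ) * groundRay γ ε r) (Ioi 1) := by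
    refine ContinuousOn.mul ?_ ?_
    · refine Complex.continuous_ofReal.comp_continuousOn (ContinuousOn.sub
        (continuousOn_const.mul (continuousOn_inv₀.mono fun r hr => ?_)) continuousOn_const)
      have hr1 : (1 : ℝ) < r := hr
      exact (show r ≠ 0 by linarith)
    · exact Complex.continuous_ofReal.comp_continuousOn
        ((continuousOn_groundRay γ ε).mono (Ioi_subset_Ioi zero_le_one))
  refine hasWeakDerivOn_of_absolutelyContinuous isOpen_Ioi ordConnected_Ioi
    (hfc.locallyIntegrableOn measurableSet_Ioi) (hgc.locallyIntegrableOn measurableSet_Ioi)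
    (fun x hx y hy => ?_) (Eventually.of_forall hd)
  have hsub : uIcc x y ⊆ Ioi 1 := ordConnected_Ioi.uIcc_subset hx hy
  exact absolutelyContinuousOnInterval_of_eq_add_integral
    (hgc.mono hsub).intervalIntegrable fun z hz => by
      have hsub' : uIcc x z ⊆ Ioi 1 := ordConnected_Ioi.uIcc_subset hx (hsub hz)
      rw [intervalIntegral.integral_eq_sub_of_hasDerivAt (fun t ht => hd t (hsub' ht))
        (hgc.mono hsub').intervalIntegrable]
      ring

/-- The trial functions: they are in `H¹(Γ)`, the square on the circle vanishes and the square on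
the half-line is small. -/
theorem exists_trial (ha : MemLp a 2 (volume.restrict circleEdge)) {k γ ε : ℝ} (hk : 0 < k)
    (hk2 : k < 1 / 2) (hγ : 0 < γ) (hε : 0 < ε) :
    ∃ u : graph → ℂ, MemH1 u ∧
      (∀ θ ∈ circleEdge, onCircle u θ = trialCircle a k θ) ∧
      (∫ θ in circleEdge, ‖circleRemainder k (circleConst a k * onRay u 1)
        (gaugedCircle a u) (gaugedDeriv a u) θ‖ ^ 2) = 0 ∧
      ∫ r in rayEdge, ‖rayRemainder γ (onRay u) (weakDerivOn rayEdge (onRay u)) r‖ ^ 2 =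
        ε ^ 2 * ∫ r in Ioi 1, groundRay γ ε r ^ 2 := by
  have hπ := Real.pi_pos
  have hsin : 0 < Real.sin (k * Real.pi) := Real.sin_pos_of_pos_of_lt_pi (by positivity)
    (by nlinarith)
  have hcos : 0 < Real.cos (k * Real.pi) := Real.cos_pos_of_mem_Ioo ⟨by nlinarith, by nlinarith⟩
  have hac := absolutelyContinuousOnInterval_trialCircle ha hk.ne'
  have hwc := hac.continuousOn
  rw [uIcc_of_le Real.two_pi_pos.le] at hwc
  have hw0 : trialCircle a k 0 = 1 := by
    rw [trialCircle, gauge_zero, groundCircle_zero hcos.ne', one_mul]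
  have hw1 : trialCircle a k (2 * Real.pi) = 1 := by
    rw [trialCircle, groundCircle_two_pi hk.ne' hcos.ne' hsin.ne', mul_comm, gauge_neg_mul_gauge]
  have hρ1 : ((groundRay γ ε 1 : ℝ) : ℂ) = 1 := by simp [groundRay]
  have hρc := (continuousOn_groundRay γ ε).mono (Ici_subset_Ioi.2 one_pos)
  obtain ⟨u, hu, hc, hr⟩ := exists_continuous_onCircle_onRay hwc hw0 hw1
    (ρ := fun r => ((groundRay γ ε r : ℝ) : ℂ)) (Complex.continuous_ofReal.comp_continuousOn hρc)
    hρ1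
  have hc' : ∀ θ ∈ circleEdge, onCircle u θ = trialCircle a k θ := fun θ hθ =>
    hc θ (Ioo_subset_Ico_self hθ)
  have hsub : circleEdge ⊆ uIcc 0 (2 * Real.pi) := by
    rw [uIcc_of_le Real.two_pi_pos.le]
    exact Ioo_subset_Icc_self
  have hgL := memLp_trialCircleDeriv ha hk.ne'
  have hcw : HasWeakDerivOn circleEdge (onCircle u) (trialCircleDeriv a k) := by
    refine hasWeakDerivOn_of_absolutelyContinuous isOpen_Ioo ordConnected_Ioo
      ((continuous_onCircle hu).locallyIntegrable.locallyIntegrableOn _) ?_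
      (fun x hx y hy => ?_) ?_
    · have : IntegrableOn (trialCircleDeriv a k) circleEdge := by
        have h := intervalIntegrable_of_memLp hgL
        rwa [intervalIntegrable_iff_integrableOn_Ioo_of_le Real.two_pi_pos.le] at h
      exact this.locallyIntegrableOn
    · exact (hac.mono (uIcc_subset_uIcc (hsub hx) (hsub hy))).congr fun z hz =>
        hc' z (ordConnected_Ioo.uIcc_subset hx hy hz)
    · filter_upwards [ae_hasDerivAt_trialCircle ha hk.ne'] with θ h hθ
      refine (h (hsub hθ)).congr_of_eventuallyEq ?_
      filter_upwards [isOpen_Ioo.mem_nhds hθ] with z hz using hc' z hz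
  have hrw := hasWeakDerivOn_groundRay (γ := γ) (ε := ε) hr
  have hρL : MemLp (fun r => ((groundRay γ ε r : ℝ) : ℂ)) 2 (volume.restrict (Ioi 1)) :=
    memLp_ofReal_of_sq ((hρc.mono Ioi_subset_Ici_self).aestronglyMeasurable measurableSet_Ioi)
      ((integrableOn_groundRay_sq hγ hε).mono_set (Ioi_subset_Ioi zero_le_one))
  have hrL : MemLp (onRay u) 2 (volume.restrict rayEdge) := by
    refine hρL.ae_eq ((ae_restrict_iff' measurableSet_Ioi).2 (Eventually.of_forall fun r h => ?_))
    exact (hr r (le_of_lt h)).symm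
  have hrgL : MemLp (fun r => ((γ * r⁻¹ - ε : ℝ) : ℂ) * groundRay γ ε r) 2
      (volume.restrict rayEdge) := by
    refine ((memLp_inv_mul hρL γ).sub (hρL.const_mul (ε : ℂ))).ae_eq (Eventually.of_forall
      fun r => ?_)
    simp only [Pi.sub_apply]
    push_cast
    ring
  refine ⟨u, ⟨hu, ⟨memLp_of_continuous (continuous_onCircle hu), _, hcw, hgL⟩,
    ⟨hrL, _, hrw, hrgL⟩⟩, hc', ?_, ?_⟩
  · refine integral_eq_zero_of_ae ?_
    have hoc : IsOpen circleEdge := isOpen_Ioo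
    have hae := hcw.weakDerivOn_ae_eq hoc
    rw [EventuallyEq, ae_restrict_iff' hoc.measurableSet] at hae ⊢
    filter_upwards [hae] with θ h hθ
    have h1 : gaugedCircle a u θ = groundCircle k (circleConst a k) θ := by
      rw [gaugedCircle, hc' θ hθ, trialCircle, ← mul_assoc, gauge_neg_mul_gauge, one_mul]
    have h2 : gaugedDeriv a u θ = groundCircleDeriv k (circleConst a k) θ := by
      rw [gaugedDeriv, h hθ, hc' θ hθ, trialCircle, trialCircleDeriv]
      linear_combination (groundCircleDeriv k (circleConst a k) θ) * gauge_neg_mul_gauge a θ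
    have h3 := circleRemainder_groundCircle hk.ne'
      (cos_mul_sub_pi_pos hk hk2 (Ioo_subset_Icc_self hθ)).ne' hcos.ne' (circleConst a k)
    rw [circleRemainder] at h3
    rw [hr 1 le_rfl, hρ1, mul_one, circleRemainder, h1, h2, h3]
    simp
  · rw [← integral_const_mul]
    refine integral_congr_ae ?_
    have hor : IsOpen rayEdge := isOpen_Ioi
    have hae := hrw.weakDerivOn_ae_eq hor
    rw [EventuallyEq, ae_restrict_iff' hor.measurableSet] at hae ⊢
    filter_upwards [hae] with r h hrm
    have h1 : rayRemainder γ (onRay u) (weakDerivOn rayEdge (onRay u)) r =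
        ((-(ε * groundRay γ ε r) : ℝ) : ℂ) := by
      rw [rayRemainder, h hrm, hr r (le_of_lt hrm)]
      push_cast
      ring
    rw [h1, Complex.norm_real, norm_neg, Real.norm_eq_abs, sq_abs, mul_pow]

/-! ### Sharpness and uniqueness -/

theorem tendsto_rayError {γ : ℝ} (hγ : γ < 1 / 2) :
    Tendsto (fun ε : ℝ => ε ^ 2 * (Real.exp (2 * ε) *
      ((1 / (2 * ε)) ^ (2 * γ + 1) * Real.Gamma (2 * γ + 1)))) (𝓝[>] 0) (𝓝 0) := by
  have h1 : Tendsto (fun ε : ℝ => Real.exp (2 * ε) * (1 / 4 * (2 * ε) ^ (1 - 2 * γ) *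
      Real.Gamma (2 * γ + 1))) (𝓝[>] 0) (𝓝 0) := by
    have hc : ContinuousAt (fun ε : ℝ => Real.exp (2 * ε) * (1 / 4 * (2 * ε) ^ (1 - 2 * γ) *
        Real.Gamma (2 * γ + 1))) 0 := by
      have : ContinuousAt (fun ε : ℝ => (2 * ε) ^ (1 - 2 * γ)) 0 :=
        ContinuousAt.rpow_const (by fun_prop) (Or.inr (by linarith))
      fun_prop
    have h := hc.tendsto
    rw [mul_zero, Real.zero_rpow (by linarith), mul_zero, zero_mul, mul_zero] at h
    exact h.mono_left nhdsWithin_le_nhds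
  refine h1.congr' ?_
  filter_upwards [self_mem_nhdsWithin] with ε hε
  have h2 : 0 < 2 * ε := mul_pos two_pos hε
  -- The prefactor `ε²` outweighs the growth `(2ε)^(-2γ-1)`, leaving a positive power of `ε`.
  have h3 : (2 * ε) ^ (1 - 2 * γ) = (2 * ε) ^ 2 * (1 / (2 * ε)) ^ (2 * γ + 1) := by
    rw [one_div, Real.inv_rpow h2.le, ← Real.rpow_neg h2.le, ← Real.rpow_natCast,
      ← Real.rpow_add h2]
    congr 1
    push_cast
    ring
  rw [h3]
  ring

/-- The solutions of the transcendental equation are sharp constants. -/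
theorem le_of_hardyInequality (ha : MemLp a 2 (volume.restrict circleEdge)) {lam C : ℝ}
    (hlam : IsLambdaRoot (distInt (flux a)) lam) (hC : HardyInequality a C) : C ≤ lam := by
  obtain ⟨hk, hk2, hq⟩ := hlam.bounds
  have hγ := rayExponent_pos hlam.1.1
  by_contra! hlt
  -- The circle part of the trial functions does not depend on `ε`, so `M` bounds their weighted
  -- norms from below uniformly. If `C > λ`, the fixed positive number `(C - λ) M` would be at most
  -- an error tending to zero.
  set M := ∫ θ in circleEdge, ‖trialCircle a (√lam) θ‖ ^ 2 with hM
  have hMpos : 0 < M := by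
    have hwc := (absolutelyContinuousOnInterval_trialCircle ha hk.ne').continuousOn
    rw [uIcc_of_le Real.two_pi_pos.le] at hwc
    have hcos : 0 < Real.cos (√lam * Real.pi) := Real.cos_pos_of_mem_Ioo
      ⟨by nlinarith [Real.pi_pos], by nlinarith [Real.pi_pos]⟩
    rw [hM, setIntegral_circleEdge]
    refine intervalIntegral.integral_pos Real.two_pi_pos (hwc.norm.pow 2)
      (fun _ _ => sq_nonneg _) ⟨0, by simp [Real.pi_pos.le], ?_⟩
    rw [trialCircle, gauge_zero, groundCircle_zero hcos.ne']
    simp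
  have key : ∀ ε : ℝ, 0 < ε → (C - lam) * M ≤ ε ^ 2 * (Real.exp (2 * ε) *
      ((1 / (2 * ε)) ^ (2 * rayExponent lam + 1) * Real.Gamma (2 * rayExponent lam + 1))) := by
    intro ε hε
    obtain ⟨u, hu, hc, h0, h1⟩ := exists_trial ha hk hk2 hγ hε
    have hid := magneticForm_sub_eq ha hlam hu
    rw [h0, h1, zero_add] at hid
    have hle := hC u hu
    have hMle : M ≤ graphIntegral (fun x => weight x * ‖u x‖ ^ 2) := by
      have e1 : ∫ θ in circleEdge, onCircle (fun x => weight x * ‖u x‖ ^ 2) θ = M :=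
        setIntegral_congr_fun measurableSet_Ioo fun θ hθ => by
          simp only [onCircle_weight_mul]
          rw [hc θ hθ]
      have e2 : 0 ≤ ∫ r in rayEdge, onRay (fun x => weight x * ‖u x‖ ^ 2) r :=
        setIntegral_nonneg measurableSet_Ioi fun r hr => by
          rw [onRay_weight_mul hr]
          positivity
      rw [graphIntegral, e1]
      linarith
    have hI := mul_le_mul_of_nonneg_left (integral_groundRay_sq_le hγ hε) (sq_nonneg ε)
    have hMl := mul_le_mul_of_nonneg_left hMle (sub_pos.2 hlt).le
    linarith
  have := ge_of_tendsto (tendsto_rayError (rayExponent_lt hq))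
    (by filter_upwards [self_mem_nhdsWithin] with ε hε using key ε hε)
  exact absurd this (not_le.2 (mul_pos (sub_pos.2 hlt) hMpos))

theorem isLambdaRoot_lambdaStar {α : ℝ} (hα : ¬∃ n : ℤ, α = (n : ℝ)) :
    IsLambdaRoot (distInt α) (lambdaStar α) := by
  have h := exists_isLambdaRoot (distInt_pos hα) (distInt_le_half α)
  rw [lambdaStar, dif_pos h]
  exact h.choose_spec

end LoopGraph

end

theorem mainTheorem3 (a : ℝ → ℝ) (ha : MemLp a 2 (volume.restrict LoopGraph.circleEdge))
    (hα : ¬ ∃ n : ℤ, LoopGraph.flux a = (n : ℝ)) :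
    -- `λ_*(α)` is the unique root of the equation in the interval
    (LoopGraph.IsLambdaRoot (LoopGraph.distInt (LoopGraph.flux a))
        (LoopGraph.lambdaStar (LoopGraph.flux a)) ∧
      ∀ lam : ℝ, LoopGraph.IsLambdaRoot (LoopGraph.distInt (LoopGraph.flux a)) lam →
        lam = LoopGraph.lambdaStar (LoopGraph.flux a)) ∧
    -- all the integrals are finite
    (∀ u : LoopGraph.graph → ℂ, LoopGraph.MemH1 u →
      IntegrableOn (LoopGraph.magneticDensity a u) LoopGraph.circleEdge ∧
      IntegrableOn (LoopGraph.rayDensity u) LoopGraph.rayEdge ∧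
      LoopGraph.GraphIntegrable (fun x => LoopGraph.weight x * ‖u x‖ ^ 2)) ∧
    -- the Hardy inequality
    LoopGraph.HardyInequality a (LoopGraph.lambdaStar (LoopGraph.flux a)) ∧
    -- sharpness of the constant
    (∀ C : ℝ, LoopGraph.HardyInequality a C → C ≤ LoopGraph.lambdaStar (LoopGraph.flux a)) := by
  have hroot := LoopGraph.isLambdaRoot_lambdaStar hα
  have hardy := LoopGraph.hardyInequality_of_isLambdaRoot ha hroot
  refine ⟨⟨hroot, fun lam hlam => le_antisymm ?_ ?_⟩, fun u hu =>
    ⟨LoopGraph.integrableOn_magneticDensity ha hu, LoopGraph.integrableOn_rayDensity hu,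
      LoopGraph.graphIntegrable_weight_mul hu⟩, hardy,
    fun C hC => LoopGraph.le_of_hardyInequality ha hroot hC⟩
  -- Uniqueness: each of the two roots is an admissible Hardy constant, and each bounds all
  -- admissible constants, so each is at most the other.
  · exact LoopGraph.le_of_hardyInequality ha hroot
      (LoopGraph.hardyInequality_of_isLambdaRoot ha hlam)
  · exact LoopGraph.le_of_hardyInequality ha hlam hardy
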